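/- Let $N\ge 2$, $R>0$, and $\Omega=B(0,R)\subset\mathbb R^N$ the open ball. For $u\in L^1(\Omega)$ let $$TV(u)=\int_\Omega|Du|=\sup\Big\{\int_\Omega u\,\mathrm{div}\,\varphi\,dx \;:\; \varphi\in C_c^\infty(\Omega,\mathbb R^N),\ |\varphi(x)|\le 1\ \text{for all } x\in\Omega\Big\}\in[0,\infty],$$ and let $BV(\Omega)$ be the set of $u\in L^1(\Omega)$ with $TV(u)<\infty$. For $\lambda>0$ and $g\in L^2(\Omega)$ let $$T_\lambda(g)=\operatorname*{arg\,min}_{u\in BV(\Omega)}\ \lambda\int_\Omega|Du|+\tfrac12\|u-g\|_{L^2(\Omega)}^2,$$ and let $T_0$ be the identity of $L^2(\Omega)$. Then: 1. For every $\lambda>0$ and every $g\in L^2(\Omega)$ the minimizer $T_\lambda(g)\in L^2(\Omega)\cap BV(\Omega)$ exists and is unique (as a class of functions up to equality almost everywhere), and $T_\lambda=(I+\lambda\,\partial TV)^{-1}$, where $\partial TV$ is the subdifferential in $L^2(\Omega)$ of $TV:L^2(\Omega)\to[0,\infty]$; that is, $u=T_\lambda(g)$ if and only if $g\in u+\lambda\,\partial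 TV(u)$. 2. If $g\in L^2(\Omega)$ is radial (that is, $g(x)$ agrees for almost every $x\in\Omega$ with a function of $|x|$), then for all real $\mu>\lambda\ge 0$ $$T_\mu(g)=T_{\mu-\lambda}\big(T_\lambda(g)\big).$$ -/

import Mathlib

open MeasureTheory
open scoped ENNReal ContDiff

noncomputable section

namespace ROF

/-- The space `ℝ^N` with its Euclidean norm. -/
abbrev Euc (N : ℕ) : Type := EuclideanSpace ℝ (Fin N)

variable {N : ℕ}

/-- The divergence `∑ i, ∂ φ_i / ∂ x_i` of a vector field. -/
def divergence (φ : Euc N → Euc N) (x : Euc N) : ℝ :=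
  ∑ i : Fin N, (fderiv ℝ φ x (EuclideanSpace.single i 1)) i

/-- Smooth vector fields with compact support in `Ω` and pointwise Euclidean norm at most one. -/
structure IsTestField (Ω : Set (Euc N)) (φ : Euc N → Euc N) : Prop where
  smooth : ContDiff ℝ ∞ φ
  compactSupport : HasCompactSupport φ
  support_subset : tsupport φ ⊆ Ω
  norm_le_one : ∀ x ∈ Ω, ‖φ x‖ ≤ 1

/-- The total variation `|Du|(Ω)`, with values in `[0, ∞]`. Since `φ = 0` is a test field, taking
positive parts does not change the supremum. -/
def TV (Ω : Set (Euc N)) (u : Euc N → ℝ) : ℝ≥0∞ :=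
  ⨆ (φ : Euc N → Euc N) (_ : IsTestField Ω φ),
    ENNReal.ofReal (∫ x in Ω, u x * divergence φ x)

/-- `u ∈ BV(Ω)`: `u` is integrable on `Ω` and has finite total variation there. -/
structure MemBV (Ω : Set (Euc N)) (u : Euc N → ℝ) : Prop where
  integrable : IntegrableOn u Ω
  tv_lt_top : TV Ω u < ⊤

/-- The Hilbert space `L²(Ω)`. -/
abbrev L2 (Ω : Set (Euc N)) : Type := Lp ℝ 2 (volume.restrict Ω)

/-- The energy `lam ∫_Ω |Du| + (1/2) ‖u - g‖₂²`, with values in `[0, ∞]`; it is infinite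
when `u - g` is not square integrable. -/
def energy (Ω : Set (Euc N)) (lam : ℝ) (g u : Euc N → ℝ) : ℝ≥0∞ :=
  ENNReal.ofReal lam * TV Ω u + 2⁻¹ * ∫⁻ x in Ω, ‖u x - g x‖ₑ ^ 2

/-- `u` minimizes the energy with parameter `lam` and datum `g` over `BV(Ω)`. -/
structure IsMinimizer (Ω : Set (Euc N)) (lam : ℝ) (g u : L2 Ω) : Prop where
  memBV : MemBV Ω u
  le : ∀ v : Euc N → ℝ, MemBV Ω v → energy Ω lam g u ≤ energy Ω lam g v

open Classical in
/-- The operator `T_lam` on `L²(Ω)`: `T_0` is the identity, and for `lam > 0`, `T_lam g` is the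
minimizer over `BV(Ω)` of the energy with datum `g`. -/
def T (Ω : Set (Euc N)) (lam : ℝ) (g : L2 Ω) : L2 Ω :=
  if lam = 0 then g
  else if h : ∃ u : L2 Ω, IsMinimizer Ω lam g u then h.choose
  else 0

/-- The subdifferential at `u` of the total variation, as a functional `L²(Ω) → [0, ∞]`. -/
def subdiffTV (Ω : Set (Euc N)) (u : L2 Ω) : Set (L2 Ω) :=
  {p | TV Ω u < ⊤ ∧
    ∀ v : L2 Ω, (TV Ω u : EReal) + ((inner ℝ p (v - u) : ℝ) : EReal) ≤ (TV Ω v : EReal)}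

/-- `g` is radial: it agrees almost everywhere on `Ω` with a function of `‖x‖`. -/
def IsRadial (Ω : Set (Euc N)) (g : L2 Ω) : Prop :=
  ∃ γ : ℝ → ℝ, ∀ᵐ x ∂(volume.restrict Ω), g x = γ ‖x‖

end ROF

end

/-! Let K be the closure in L² of the divergences of test fields. TV is the support function of K,
so a subgradient at u is a point p of K that maximizes ⟪u, ·⟫ over K. The resolvent is then Moreau's
decomposition g = u + ν p, with p the projection of g/ν onto K (`exists_isSupport_add_smul`), and a
strong convexity estimate makes u the unique minimizer (`energy_add_le`).

For the semigroup property write g = u + λ p and u = w + ν q, with p and q subgradients at u and w.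
If p is also a subgradient at w, so is r = (λ p + ν q)/(λ + ν), and g = w + (λ + ν) r is the
required decomposition. It remains to see that a subgradient at w + ν q is one at w.

Take g to be a radial step function; then p, q, u and w are step functions on the same annuli
(`IsConcaveChain.exists_eq_step`). Such a function lies in K exactly when its integral over each
ball of the grid is at most the perimeter in absolute value and its total integral vanishes. It is a
subgradient at w when this bound is attained, with the right sign, at every radius where w jumps
(`IsConcaveChain.isSupport_step_iff`). There the integral of q, as a function of volume, touches its
bound. The perimeter is a concave function of volume, so q cannot jump in the direction opposite to
w (`IsConcaveChain.sub_nonneg_of_eq`). Adding ν q thus cancels no jump of w, and p, which attains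
the bound at the jumps of w + ν q, attains it at those of w.

The geometric inputs are the flux bound `abs_setIntegral_divergence_ball_le` and its converse for
radial step functions, `sum_smul_ballIndicator_mem_closure`. General radial data follow by density,
since resolvents are nonexpansive. -/

namespace ROF

/-! ### Resolvents of support functions in a Hilbert space. -/

section Hilbert

variable {H : Type*} [NormedAddCommGroup H] [InnerProductSpace ℝ H]

/-- `p` belongs to `K` and maximizes the linear form `⟪u, ·⟫` over `K`. -/
def IsSupport (K : Set H) (u p : H) : Prop :=
  p ∈ K ∧ ∀ k ∈ K, inner ℝ u k ≤ inner ℝ u p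

/-- Project ν⁻¹ g onto K: the variational inequality of the projection, multiplied by ν, is the
support condition at the remainder g - ν p. -/
theorem exists_isSupport_add_smul [CompleteSpace H] {K : Set H} (hne : K.Nonempty)
    (hcl : IsClosed K) (hcv : Convex ℝ K) {ν : ℝ} (hν : 0 < ν) (g : H) :
    ∃ u p, IsSupport K u p ∧ g = u + ν • p := by
  obtain ⟨p, hp, hmin⟩ := exists_norm_eq_iInf_of_complete_convex hne hcl.isComplete hcv (ν⁻¹ • g)
  rw [norm_eq_iInf_iff_real_inner_le_zero hcv hp] at hmin
  refine ⟨g - ν • p, p, ⟨hp, fun k hk => ?_⟩, by abel⟩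
  have h := hmin k hk
  have e : g - ν • p = ν • (ν⁻¹ • g - p) := by
    rw [smul_sub, smul_smul, mul_inv_cancel₀ hν.ne', one_smul]
  rw [inner_sub_right] at h
  rw [e, real_inner_smul_left, real_inner_smul_left]
  exact mul_le_mul_of_nonneg_left (by linarith) hν.le

theorem IsSupport.inner_sub_nonneg {K : Set H} {u p u' p' : H} (h : IsSupport K u p)
    (h' : IsSupport K u' p') : 0 ≤ inner ℝ (u - u') (p - p') := by
  have h1 := h.2 p' h'.1
  have h2 := h'.2 p h.1
  simp only [inner_sub_left, inner_sub_right]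
  linarith

theorem norm_le_of_inner_nonneg {ν : ℝ} (hν : 0 ≤ ν) {a b : H} (h : 0 ≤ inner ℝ a b) :
    ‖a‖ ≤ ‖a + ν • b‖ := by
  have h1 : ‖a‖ ^ 2 ≤ ‖a + ν • b‖ ^ 2 := by
    rw [norm_add_sq_real, real_inner_smul_right]
    linarith [mul_nonneg hν h, sq_nonneg ‖ν • b‖]
  exact le_of_sq_le_sq h1 (norm_nonneg _)

/-- Monotonicity of the subdifferential makes the resolvent nonexpansive, which later gives its
continuity. -/
theorem IsSupport.norm_sub_le {K : Set H} {u p u' p' : H} (h : IsSupport K u p)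
    (h' : IsSupport K u' p') {ν : ℝ} (hν : 0 ≤ ν) :
    ‖u - u'‖ ≤ ‖(u + ν • p) - (u' + ν • p')‖ := by
  have := norm_le_of_inner_nonneg hν (h.inner_sub_nonneg h')
  rwa [show (u + ν • p) - (u' + ν • p') = u - u' + ν • (p - p') by rw [smul_sub]; abel]

/-! ### Step functions on a concave chain. -/

/-- The combination of the increments of `x` with coefficients `a`. -/
def step (n : ℕ) (x : ℕ → H) (a : ℕ → ℝ) : H :=
  ∑ k ∈ Finset.range n, a k • (x (k + 1) - x k)

theorem step_add_smul (n : ℕ) (x : ℕ → H) (a b : ℕ → ℝ) (s : ℝ) :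
    step n x a + s • step n x b = step n x (fun k => a k + s * b k) := by
  simp only [step, Finset.smul_sum, ← Finset.sum_add_distrib, add_smul, smul_smul]

theorem inner_step (n : ℕ) (x : ℕ → H) (a : ℕ → ℝ) (p : H) :
    inner ℝ (step n x a) p =
      ∑ k ∈ Finset.range n, a k * (inner ℝ (x (k + 1)) p - inner ℝ (x k) p) := by
  simp only [step, sum_inner, real_inner_smul_left, inner_sub_left]

/-- A chain of vectors with the inner products of nested indicator functions, on which a convex
set `K` is described by bounds `c` that are concave with respect to the measures `t`. -/
structure IsConcaveChain (K : Set H) (n : ℕ) (x : ℕ → H) (t c : ℕ → ℝ) : Prop where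
  lt : ∀ k < n, t k < t (k + 1)
  zero : x 0 = 0
  inner_eq : ∀ j k, j ≤ k → k ≤ n → inner ℝ (x j) (x k) = t j
  concave : ∀ k, k + 1 < n →
    (c (k + 2) - c (k + 1)) / (t (k + 2) - t (k + 1)) ≤ (c (k + 1) - c k) / (t (k + 1) - t k)
  abs_le : ∀ p ∈ K, ∀ k ≤ n, |inner ℝ (x k) p| ≤ c k
  last : ∀ p ∈ K, inner ℝ (x n) p = 0
  mem : ∀ a : ℕ → ℝ, (∀ k ≤ n, |inner ℝ (x k) (step n x a)| ≤ c k) →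
    inner ℝ (x n) (step n x a) = 0 → step n x a ∈ K

namespace IsConcaveChain

variable {K : Set H} {n : ℕ} {x : ℕ → H} {t c : ℕ → ℝ}

/-- The increments model indicators of disjoint annuli, hence are orthogonal. -/
theorem inner_increment (h : IsConcaveChain K n x t c) {j k : ℕ} (hj : j < n) (hk : k < n) :
    inner ℝ (x (j + 1) - x j) (x (k + 1) - x k) = if j = k then t (k + 1) - t k else 0 := by
  have key : ∀ j k, j < n → k < n → j < k →
      inner ℝ (x (j + 1) - x j) (x (k + 1) - x k) = 0 := by
    intro j k hj hk hjk
    rw [inner_sub_left, inner_sub_right, inner_sub_right, h.inner_eq _ _ (by omega) (by omega),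
      h.inner_eq _ _ (by omega) (by omega), h.inner_eq _ _ (by omega) (by omega),
      h.inner_eq _ _ (by omega) (by omega)]
    ring
  rcases lt_trichotomy j k with hjk | rfl | hjk
  · rw [if_neg hjk.ne, key j k hj hk hjk]
  · rw [if_pos rfl, inner_sub_left, inner_sub_right, inner_sub_right,
      real_inner_comm (x j) (x (j + 1)),
      h.inner_eq _ _ le_rfl (by omega), h.inner_eq _ _ (by omega) (by omega),
      h.inner_eq _ _ le_rfl (by omega)]
    ring
  · rw [if_neg hjk.ne', real_inner_comm, key k j hk hj hjk]

theorem inner_increment_step (h : IsConcaveChain K n x t c) {k : ℕ} (hk : k < n) (a : ℕ → ℝ) :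
    inner ℝ (x (k + 1)) (step n x a) - inner ℝ (x k) (step n x a) = a k * (t (k + 1) - t k) := by
  rw [← inner_sub_left, step, inner_sum, Finset.sum_eq_single k]
  · rw [real_inner_smul_right, h.inner_increment hk hk, if_pos rfl]
  · intro j hj hjk
    rw [real_inner_smul_right, h.inner_increment hk (Finset.mem_range.1 hj), if_neg hjk.symm,
      mul_zero]
  · exact fun h' => absurd (Finset.mem_range.2 hk) h'

/-- The coefficients are the difference quotients of `F` with respect to `t`; the pairings then
telescope. -/
theorem exists_step (h : IsConcaveChain K n x t c) (F : ℕ → ℝ) (hF : F 0 = 0) :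
    ∃ a, ∀ k ≤ n, inner ℝ (x k) (step n x a) = F k := by
  refine ⟨fun k => (F (k + 1) - F k) / (t (k + 1) - t k), fun k => ?_⟩
  induction k with
  | zero => intro _; rw [h.zero, inner_zero_left, hF]
  | succ k ih =>
    intro hk
    have h1 := h.inner_increment_step (k := k) (by omega)
      (fun k => (F (k + 1) - F k) / (t (k + 1) - t k))
    have h2 := h.lt k (by omega)
    rw [div_mul_cancel₀ _ (by linarith)] at h1
    have := ih (by omega)
    linarith

/-- The orthogonal projection onto the span of the chain maps `K` into itself. -/
theorem exists_step_mem (h : IsConcaveChain K n x t c) {p : H} (hp : p ∈ K) :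
    ∃ a, step n x a ∈ K ∧ ∀ b, inner ℝ (step n x b) (step n x a) = inner ℝ (step n x b) p := by
  -- The projection is the step function with the same pairings with the chain as `p`. Membership in
  -- `K` of a step function depends on these pairings only.
  obtain ⟨a, ha⟩ := h.exists_step (fun k => inner ℝ (x k) p) (by rw [h.zero, inner_zero_left])
  refine ⟨a, h.mem a (fun k hk => ?_) ?_, fun b => ?_⟩
  · rw [ha k hk]; exact h.abs_le p hp k hk
  · rw [ha n le_rfl]; exact h.last p hp
  · rw [inner_step, inner_step]
    refine Finset.sum_congr rfl fun k hk => ?_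
    have := Finset.mem_range.1 hk
    rw [ha _ (by omega), ha _ (by omega)]

/-- If `u + ν p` lies in the span of the chain and `p` supports `K` at `u`, then `p` lies in the
span of the chain. -/
theorem exists_eq_step (h : IsConcaveChain K n x t c) {ν : ℝ} (hν : 0 < ν) {u p : H}
    (hup : IsSupport K u p) {b : ℕ → ℝ} (hg : step n x b = u + ν • p) : ∃ a, p = step n x a := by
  obtain ⟨a, haK, ha⟩ := h.exists_step_mem hup.1
  refine ⟨a, ?_⟩
  set q := step n x a
  have h1 := hup.2 q haK
  have h2 := ha b
  have h3 := ha a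
  -- With u = g - ν p and ⟪g, q⟫ = ⟪g, p⟫, the support inequality for the projection q becomes ⟪p,
  -- p⟫ ≤ ⟪p, q⟫. As ⟪q, q⟫ = ⟪q, p⟫, this forces ‖p - q‖² ≤ 0.
  rw [eq_sub_of_add_eq hg.symm, inner_sub_left, inner_sub_left, real_inner_smul_left,
    real_inner_smul_left, h2] at h1
  have h4 : inner ℝ p p ≤ inner ℝ p q := by
    have : ν * inner ℝ p p ≤ ν * inner ℝ p q := by linarith
    exact le_of_mul_le_mul_left this hν
  rw [← sub_eq_zero, ← norm_eq_zero, ← sq_eq_zero_iff]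
  refine le_antisymm ?_ (sq_nonneg _)
  rw [← real_inner_self_eq_norm_sq, inner_sub_left, inner_sub_right, inner_sub_right]
  change inner ℝ q q = inner ℝ q p at h3
  rw [real_inner_comm q p] at *
  linarith

/-- Summation by parts for the pairing of a step function with an element of `K`. -/
theorem inner_step_eq (h : IsConcaveChain K n x t c) (a : ℕ → ℝ) {p : H} (hp : p ∈ K) :
    inner ℝ (step n x a) p =
      ∑ k ∈ Finset.range (n - 1), (a k - a (k + 1)) * inner ℝ (x (k + 1)) p := by
  have key : ∀ m, ∑ k ∈ Finset.range (m + 1), a k * (inner ℝ (x (k + 1)) p - inner ℝ (x k) p) =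
      ∑ k ∈ Finset.range m, (a k - a (k + 1)) * inner ℝ (x (k + 1)) p
        + a m * inner ℝ (x (m + 1)) p := by
    intro m
    induction m with
    | zero => simp [h.zero]
    | succ m ih => rw [Finset.sum_range_succ, ih, Finset.sum_range_succ]; ring
  rw [inner_step]
  rcases n with _ | m
  · simp
  · rw [key, h.last p hp, mul_zero, add_zero, Nat.add_sub_cancel]

/-- Complementary slackness. Summation by parts turns the linear form into a sum over the jumps of
`a`; each term has its own bound, and all these bounds can be attained by one element of `K`. -/
theorem isSupport_step_iff (h : IsConcaveChain K n x t c) (a : ℕ → ℝ) {p : H} (hp : p ∈ K) :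
    IsSupport K (step n x a) p ↔
      ∀ k, k + 1 < n → (a k - a (k + 1)) * inner ℝ (x (k + 1)) p = |a k - a (k + 1)| * c (k + 1) := by
  have bound : ∀ q ∈ K, ∀ k ∈ Finset.range (n - 1),
      (a k - a (k + 1)) * inner ℝ (x (k + 1)) q ≤ |a k - a (k + 1)| * c (k + 1) := by
    intro q hq k hk
    have := Finset.mem_range.1 hk
    refine (le_abs_self _).trans ?_
    rw [abs_mul]
    exact mul_le_mul_of_nonneg_left (h.abs_le q hq _ (by omega)) (abs_nonneg _)
  have c_nonneg : ∀ k ≤ n, 0 ≤ c k := fun k hk => (abs_nonneg _).trans (h.abs_le p hp k hk)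
  constructor
  · intro hs
    -- The competitor attains the bound at every interior index with the sign of the jump. At `0`
    -- and `n` the pairing must vanish, by `zero` and `last`.
    obtain ⟨b, hb⟩ := h.exists_step
      (fun k => if k = 0 ∨ k = n then 0 else SignType.sign (a (k - 1) - a k) * c k) (by simp)
    have hbK : step n x b ∈ K := by
      refine h.mem b (fun k hk => ?_) (by rw [hb n le_rfl]; simp)
      rw [hb k hk]
      split_ifs
      · simpa using c_nonneg k hk
      · rw [abs_mul, abs_of_nonneg (c_nonneg k hk)]
        refine mul_le_of_le_one_left (c_nonneg k hk) ?_
        rcases lt_trichotomy (a (k - 1) - a k) 0 with h0 | h0 | h0 <;> simp [h0]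
    have h1 := hs.2 _ hbK
    rw [h.inner_step_eq a hbK, h.inner_step_eq a hp] at h1
    have h2 : ∑ k ∈ Finset.range (n - 1), (a k - a (k + 1)) * inner ℝ (x (k + 1)) (step n x b) =
        ∑ k ∈ Finset.range (n - 1), |a k - a (k + 1)| * c (k + 1) := by
      refine Finset.sum_congr rfl fun k hk => ?_
      have := Finset.mem_range.1 hk
      rw [hb _ (by omega), if_neg (by omega), Nat.add_sub_cancel, ← mul_assoc, self_mul_sign]
    rw [h2] at h1
    have h3 := (Finset.sum_eq_sum_iff_of_le (bound p hp)).1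
      (le_antisymm (Finset.sum_le_sum (bound p hp)) h1)
    exact fun k hk => h3 k (Finset.mem_range.2 (by omega))
  · intro hs
    refine ⟨hp, fun q hq => ?_⟩
    rw [h.inner_step_eq a hq, h.inner_step_eq a hp]
    refine Finset.sum_le_sum fun k hk => ?_
    rw [hs k (by have := Finset.mem_range.1 hk; omega)]
    exact bound q hq k hk

/-- The pairing stays below `c` and touches it at `k + 1`. So its slope `a k` before is at least
that of `c`, its slope `a (k + 1)` after is at most that of `c`, and the slopes of `c` decrease. -/
theorem sub_nonneg_of_eq (h : IsConcaveChain K n x t c) {a : ℕ → ℝ} (ha : step n x a ∈ K)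
    {k : ℕ} (hk : k + 1 < n) (hc : inner ℝ (x (k + 1)) (step n x a) = c (k + 1)) :
    0 ≤ a k - a (k + 1) := by
  have e1 := h.inner_increment_step (k := k) (by omega) a
  have e2 := h.inner_increment_step (k := k + 1) (by omega) a
  have l1 := h.lt k (by omega)
  have l2 := h.lt (k + 1) (by omega)
  have b1 := (le_abs_self _).trans (h.abs_le _ ha k (by omega))
  have b2 := (le_abs_self _).trans (h.abs_le _ ha (k + 2) (by omega))
  have h1 : (c (k + 1) - c k) / (t (k + 1) - t k) ≤ a k := by
    rw [div_le_iff₀ (by linarith)]; linarith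
  have h2 : a (k + 1) ≤ (c (k + 2) - c (k + 1)) / (t (k + 2) - t (k + 1)) := by
    rw [le_div_iff₀ (by linarith)]
    change inner ℝ (x (k + 2)) (step n x a) - inner ℝ (x (k + 1)) (step n x a) =
      a (k + 1) * (t (k + 2) - t (k + 1)) at e2
    linarith
  linarith [h.concave k hk]

theorem sub_nonpos_of_eq_neg (h : IsConcaveChain K n x t c) {a : ℕ → ℝ} (ha : step n x a ∈ K)
    {k : ℕ} (hk : k + 1 < n) (hc : inner ℝ (x (k + 1)) (step n x a) = -c (k + 1)) :
    a k - a (k + 1) ≤ 0 := by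
  have e1 := h.inner_increment_step (k := k) (by omega) a
  have e2 := h.inner_increment_step (k := k + 1) (by omega) a
  have l1 := h.lt k (by omega)
  have l2 := h.lt (k + 1) (by omega)
  have b1 := neg_le_of_abs_le (h.abs_le _ ha k (by omega))
  have b2 := neg_le_of_abs_le (h.abs_le _ ha (k + 2) (by omega))
  have h1 : -a k ≥ (c (k + 1) - c k) / (t (k + 1) - t k) := by
    rw [ge_iff_le, div_le_iff₀ (by linarith)]; linarith
  have h2 : -a (k + 1) ≤ (c (k + 2) - c (k + 1)) / (t (k + 2) - t (k + 1)) := by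
    rw [le_div_iff₀ (by linarith)]
    change inner ℝ (x (k + 2)) (step n x a) - inner ℝ (x (k + 1)) (step n x a) =
      a (k + 1) * (t (k + 2) - t (k + 1)) at e2
    linarith
  linarith [h.concave k hk]

/-- A support of `K` at `w + ν q` is a support at `w`, if `q` is one at `w`. -/
theorem isSupport_of_add_smul (h : IsConcaveChain K n x t c) {ν : ℝ} (hν : 0 ≤ ν) {a b : ℕ → ℝ}
    {p : H} (hq : IsSupport K (step n x a) (step n x b))
    (hp : IsSupport K (step n x a + ν • step n x b) p) : IsSupport K (step n x a) p := by
  have hpK := hp.1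
  rw [step_add_smul, h.isSupport_step_iff _ hp.1] at hp
  have hqK := hq.1
  rw [h.isSupport_step_iff _ hqK] at hq
  rw [h.isSupport_step_iff _ hpK]
  intro k hk
  have h1 := hq k hk
  have h2 := hp k hk
  -- At a jump of w, q attains the bound with the sign of that jump, so the jump of q there is zero
  -- or of the same sign. The jump of w + ν q keeps the sign, and slackness for p at w + ν q yields
  -- slackness at w. Without a jump nothing is required.
  rcases lt_trichotomy (a k - a (k + 1)) 0 with h0 | h0 | h0
  · rw [abs_of_neg h0, neg_mul, ← mul_neg] at h1 ⊢
    have h3 := mul_nonneg_of_nonpos_of_nonpos (neg_nonpos.2 hν)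
      (h.sub_nonpos_of_eq_neg hqK hk (mul_left_cancel₀ h0.ne h1))
    have h4 : a k + ν * b k - (a (k + 1) + ν * b (k + 1)) < 0 := by linarith
    rw [abs_of_neg h4, neg_mul, ← mul_neg] at h2
    rw [mul_left_cancel₀ h4.ne h2]
  · simp [h0]
  · rw [abs_of_pos h0] at h1 ⊢
    have h3 := mul_nonneg hν (h.sub_nonneg_of_eq hqK hk (mul_left_cancel₀ h0.ne' h1))
    have h4 : 0 < a k + ν * b k - (a (k + 1) + ν * b (k + 1)) := by linarith
    rw [abs_of_pos h4] at h2
    rw [mul_left_cancel₀ h4.ne' h2]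

/-- The semigroup property of the resolvents at data in the span of the chain. -/
theorem isSupport_semigroup (h : IsConcaveChain K n x t c) (hcv : Convex ℝ K) {lam ν : ℝ}
    (hlam : 0 < lam) (hν : 0 < ν) {b : ℕ → ℝ} {u p w q : H} (hup : IsSupport K u p)
    (hg : step n x b = u + lam • p) (hwq : IsSupport K w q) (hu : u = w + ν • q) :
    ∃ r, IsSupport K w r ∧ step n x b = w + (lam + ν) • r := by
  -- Membership in the span passes from g to p, hence to u = g - λ p, then to q and to w = u - ν q.
  obtain ⟨a, rfl⟩ := h.exists_eq_step hlam hup hg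
  have hu' : step n x (fun k => b k + -lam * a k) = u := by
    rw [← step_add_smul, hg, neg_smul, add_neg_cancel_right]
  obtain ⟨d, rfl⟩ := h.exists_eq_step hν hwq (hu'.trans hu)
  have hw : w = step n x (fun k => (b k + -lam * a k) + -ν * d k) := by
    rw [← step_add_smul, hu', hu, neg_smul, add_neg_cancel_right]
  rw [hw] at hwq hu
  rw [hu] at hup
  have hs := h.isSupport_of_add_smul hν.le hwq hup
  rw [← hw] at hs hwq hu
  have hpos : 0 < lam + ν := by linarith
  -- The weights make (λ + ν) r = λ p + ν q; supports at a given point form a convex set.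
  refine ⟨(lam / (lam + ν)) • step n x a + (ν / (lam + ν)) • step n x d,
    ⟨hcv hs.1 hwq.1 (by positivity) (by positivity) (by field_simp), fun k hk => ?_⟩, ?_⟩
  · have h1 := mul_le_mul_of_nonneg_left (hs.2 k hk) (a := lam / (lam + ν)) (by positivity)
    have h2 := mul_le_mul_of_nonneg_left (hwq.2 k hk) (a := ν / (lam + ν)) (by positivity)
    have h3 : lam / (lam + ν) + ν / (lam + ν) = 1 := by field_simp
    rw [inner_add_right, real_inner_smul_right, real_inner_smul_right]
    calc inner ℝ w k = (lam / (lam + ν) + ν / (lam + ν)) * inner ℝ w k := by rw [h3, one_mul]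
      _ ≤ _ := by rw [add_mul]; exact add_le_add h1 h2
  · rw [hg, hu, smul_add, smul_smul, smul_smul, mul_div_cancel₀ _ hpos.ne',
      mul_div_cancel₀ _ hpos.ne']
    abel

end IsConcaveChain
end Hilbert

/-! ### Divergences of test fields, and total variation as a support function. -/

variable {N : ℕ}

theorem divergence_combination {φ ψ : Euc N → Euc N} (hφ : ContDiff ℝ ∞ φ) (hψ : ContDiff ℝ ∞ ψ)
    (a b : ℝ) (x : Euc N) :
    divergence (a • φ + b • ψ) x = a * divergence φ x + b * divergence ψ x := by
  have h1 := (hφ.differentiable (by simp)) x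
  have h2 := (hψ.differentiable (by simp)) x
  simp only [divergence, Finset.mul_sum, ← Finset.sum_add_distrib]
  rw [fderiv_add (h1.const_smul a) (h2.const_smul b), fderiv_const_smul h1, fderiv_const_smul h2]
  simp

theorem continuous_divergence {φ : Euc N → Euc N} (hφ : ContDiff ℝ ∞ φ) :
    Continuous (divergence φ) := by
  have := hφ.continuous_fderiv (by simp)
  unfold divergence
  fun_prop

theorem hasCompactSupport_divergence {φ : Euc N → Euc N} (hφ : HasCompactSupport φ) :
    HasCompactSupport (divergence φ) := by
  refine (hφ.fderiv ℝ).mono fun x hx => ?_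
  contrapose! hx
  simp only [Function.mem_support, not_not] at hx ⊢
  simp [divergence, hx]

theorem memLp_divergence {φ : Euc N → Euc N} (hφ : ContDiff ℝ ∞ φ) (hc : HasCompactSupport φ)
    (μ : Measure (Euc N)) [IsFiniteMeasureOnCompacts μ] (p : ℝ≥0∞) : MemLp (divergence φ) p μ :=
  (continuous_divergence hφ).memLp_of_hasCompactSupport (hasCompactSupport_divergence hc)

theorem IsTestField.combination {Ω : Set (Euc N)} {φ ψ : Euc N → Euc N} (hφ : IsTestField Ω φ)
    (hψ : IsTestField Ω ψ) {a b : ℝ} (hab : |a| + |b| ≤ 1) : IsTestField Ω (a • φ + b • ψ) where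
  smooth := (hφ.smooth.const_smul a).add (hψ.smooth.const_smul b)
  compactSupport := (hφ.compactSupport.smul_left (f := fun _ => a)).add
    (hψ.compactSupport.smul_left (f := fun _ => b))
  support_subset := by
    refine (closure_minimal ?_ ((isClosed_tsupport φ).union (isClosed_tsupport ψ))).trans
      (Set.union_subset hφ.support_subset hψ.support_subset)
    intro x hx
    by_contra h
    rw [Set.mem_union, not_or] at h
    exact hx (by simp [image_eq_zero_of_notMem_tsupport h.1, image_eq_zero_of_notMem_tsupport h.2])
  norm_le_one := fun x hx => by
    refine (norm_add_le _ _).trans ?_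
    simp only [Pi.smul_apply, norm_smul, Real.norm_eq_abs]
    nlinarith [hφ.norm_le_one x hx, hψ.norm_le_one x hx, abs_nonneg a, abs_nonneg b]

theorem isTestField_zero (Ω : Set (Euc N)) : IsTestField Ω (0 : Euc N → Euc N) where
  smooth := contDiff_const
  compactSupport := HasCompactSupport.zero
  support_subset := by simp [tsupport]
  norm_le_one := by simp

/-- The classes in `L²(Ω)` of the divergences of test fields. -/
def divergences (Ω : Set (Euc N)) : Set (L2 Ω) :=
  {p | ∃ φ, IsTestField Ω φ ∧ p =ᵐ[volume.restrict Ω] divergence φ}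

theorem divergences_combination {Ω : Set (Euc N)} {p q : L2 Ω} (hp : p ∈ divergences Ω)
    (hq : q ∈ divergences Ω) {a b : ℝ} (hab : |a| + |b| ≤ 1) : a • p + b • q ∈ divergences Ω := by
  obtain ⟨φ, hφ, hpφ⟩ := hp
  obtain ⟨ψ, hψ, hqψ⟩ := hq
  refine ⟨_, hφ.combination hψ hab, ?_⟩
  filter_upwards [Lp.coeFn_add (a • p) (b • q), Lp.coeFn_smul a p, Lp.coeFn_smul b q, hpφ, hqψ]
    with x h1 h2 h3 h4 h5
  rw [divergence_combination hφ.smooth hψ.smooth, h1, Pi.add_apply, h2, h3, Pi.smul_apply,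
    Pi.smul_apply, h4, h5, smul_eq_mul, smul_eq_mul]

theorem convex_divergences (Ω : Set (Euc N)) : Convex ℝ (divergences Ω) :=
  fun p hp q hq a b ha hb hab =>
    divergences_combination hp hq (by rw [abs_of_nonneg ha, abs_of_nonneg hb, hab])

theorem zero_mem_divergences (Ω : Set (Euc N)) : (0 : L2 Ω) ∈ divergences Ω := by
  refine ⟨0, isTestField_zero Ω, ?_⟩
  filter_upwards [Lp.coeFn_zero ℝ 2 (volume.restrict Ω)] with x hx
  rw [hx]
  simp [divergence]

theorem inner_eq_integral {Ω : Set (Euc N)} {u p : L2 Ω} {f : Euc N → ℝ}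
    (hf : p =ᵐ[volume.restrict Ω] f) : inner ℝ u p = ∫ x in Ω, u x * f x := by
  rw [MeasureTheory.L2.inner_def]
  refine integral_congr_ae ?_
  filter_upwards [hf] with x hx
  rw [← hx]
  simp [mul_comm]

theorem exists_mem_divergences {Ω : Set (Euc N)} {φ : Euc N → Euc N} (hφ : IsTestField Ω φ) :
    ∃ p ∈ divergences Ω, p =ᵐ[volume.restrict Ω] divergence φ :=
  ⟨(memLp_divergence hφ.smooth hφ.compactSupport _ 2).toLp, ⟨φ, hφ, MemLp.coeFn_toLp _⟩,
    MemLp.coeFn_toLp _⟩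

theorem TV_congr {Ω : Set (Euc N)} {u v : Euc N → ℝ} (h : u =ᵐ[volume.restrict Ω] v) :
    TV Ω u = TV Ω v := by
  refine iSup_congr fun φ => iSup_congr fun hφ => congrArg _ (integral_congr_ae ?_)
  filter_upwards [h] with x hx
  rw [hx]

theorem ofReal_inner_le_TV {Ω : Set (Euc N)} (u : L2 Ω) {p : L2 Ω}
    (hp : p ∈ closure (divergences Ω)) : ENNReal.ofReal (inner ℝ u p) ≤ TV Ω u := by
  refine closure_minimal (s := divergences Ω) (t := {p | ENNReal.ofReal (inner ℝ u p) ≤ TV Ω u})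
    ?_ (isClosed_le
      (ENNReal.continuous_ofReal.comp (continuous_const.inner continuous_id)) continuous_const) hp
  rintro p ⟨φ, hφ, hp⟩
  rw [Set.mem_ofPred_eq, inner_eq_integral hp]
  exact le_iSup₂_of_le φ hφ le_rfl

/-- The supremum defining `TV` is attained once the divergences are replaced by their closure. -/
theorem IsSupport.TV_eq {Ω : Set (Euc N)} {u p : L2 Ω}
    (h : IsSupport (closure (divergences Ω)) u p) : TV Ω u = ENNReal.ofReal (inner ℝ u p) := by
  refine le_antisymm (iSup₂_le fun φ hφ => ENNReal.ofReal_le_ofReal ?_) (ofReal_inner_le_TV u h.1)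
  obtain ⟨q, hq, hqφ⟩ := exists_mem_divergences hφ
  rw [← inner_eq_integral hqφ]
  exact h.2 q (subset_closure hq)

theorem IsSupport.inner_nonneg {Ω : Set (Euc N)} {u p : L2 Ω}
    (h : IsSupport (closure (divergences Ω)) u p) : 0 ≤ inner ℝ u p := by
  simpa using h.2 0 (subset_closure (zero_mem_divergences Ω))

/-! ### Minimizers, resolvents and the subdifferential. -/

theorem lintegral_enorm_sub_sq {Ω : Set (Euc N)} (u g : L2 Ω) :
    ∫⁻ x in Ω, ‖u x - g x‖ₑ ^ 2 = ENNReal.ofReal (‖u - g‖ ^ 2) := by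
  rw [Lp.norm_def, ← ENNReal.toReal_pow, ENNReal.ofReal_toReal (by simpa using Lp.eLpNorm_ne_top (u - g)),
    eLpNorm_eq_lintegral_rpow_enorm_toReal (by simp) (by simp), ← ENNReal.rpow_natCast,
    ← ENNReal.rpow_mul]
  simp only [ENNReal.toReal_ofNat, Nat.cast_ofNat, ENNReal.rpow_ofNat, one_div,
    inv_mul_cancel₀ (two_ne_zero' ℝ), ENNReal.rpow_one]
  refine lintegral_congr_ae ?_
  filter_upwards [Lp.coeFn_sub u g] with x hx
  rw [hx, Pi.sub_apply]

theorem energy_eq {Ω : Set (Euc N)} {ν t : ℝ} (hν : 0 ≤ ν) {g u : L2 Ω} (ht : 0 ≤ t)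
    (htv : TV Ω u = ENNReal.ofReal t) :
    energy Ω ν g u = ENNReal.ofReal (ν * t + 2⁻¹ * ‖u - g‖ ^ 2) := by
  rw [energy, htv, lintegral_enorm_sub_sq, ENNReal.ofReal_add (by positivity) (by positivity),
    ENNReal.ofReal_mul hν, ENNReal.ofReal_mul (by positivity), ENNReal.ofReal_inv_of_pos (by simp)]
  simp

/-- Replace `TV Ω v` by its lower bound ⟪v, p⟫, which is exact at `u`; expanding the squares leaves
exactly ½‖v - u‖². This gives both minimality and uniqueness. -/
theorem energy_add_le {Ω : Set (Euc N)} {ν : ℝ} (hν : 0 < ν) {u p : L2 Ω}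
    (h : IsSupport (closure (divergences Ω)) u p) (v : L2 Ω) :
    energy Ω ν (u + ν • p : L2 Ω) u + ENNReal.ofReal (2⁻¹ * ‖v - u‖ ^ 2) ≤
      energy Ω ν (u + ν • p : L2 Ω) v := by
  by_cases hv : TV Ω v = ⊤
  · simp [energy, hv, hν]
  rw [energy_eq hν.le h.inner_nonneg h.TV_eq, energy_eq hν.le ENNReal.toReal_nonneg
    (ENNReal.ofReal_toReal hv).symm, ← ENNReal.ofReal_add
    (add_nonneg (mul_nonneg hν.le h.inner_nonneg) (by positivity)) (by positivity)]
  refine ENNReal.ofReal_le_ofReal ?_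
  have h1 : inner ℝ v p ≤ (TV Ω v).toReal :=
    (ENNReal.ofReal_le_iff_le_toReal hv).1 (ofReal_inner_le_TV v h.1)
  have h2 : v - (u + ν • p) = (v - u) - ν • p := by abel
  have h3 : u - (u + ν • p) = -(ν • p) := by abel
  rw [h2, h3, norm_neg, norm_sub_sq_real (v - u), real_inner_smul_right, inner_sub_left]
  nlinarith [mul_le_mul_of_nonneg_left h1 hν.le]

theorem IsSupport.isMinimizer {Ω : Set (Euc N)} [IsFiniteMeasure (volume.restrict Ω)] {ν : ℝ}
    (hν : 0 < ν) {u p : L2 Ω} (h : IsSupport (closure (divergences Ω)) u p) :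
    IsMinimizer Ω ν (u + ν • p) u where
  memBV := ⟨(Lp.memLp u).integrable (by norm_num), by rw [h.TV_eq]; simp⟩
  le := fun v hv => by
    -- A BV competitor need not be in L²; if it is not, its energy is infinite, and otherwise it
    -- defines a class in L².
    by_cases hfin : ∫⁻ x in Ω, ‖v x - (u + ν • p : L2 Ω) x‖ₑ ^ 2 = ⊤
    · simp only [energy, hfin]
      simp
    have hmem : MemLp (fun x => v x - (u + ν • p : L2 Ω) x) 2 (volume.restrict Ω) := by
      refine ⟨hv.integrable.aestronglyMeasurable.sub (Lp.aestronglyMeasurable _), ?_⟩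
      rw [eLpNorm_lt_top_iff_lintegral_rpow_enorm_lt_top (by simp) (by simp)]
      simpa [lt_top_iff_ne_top] using hfin
    have hv2 : MemLp v 2 (volume.restrict Ω) := by
      convert hmem.add (Lp.memLp (u + ν • p)) using 1
      ext x
      simp
    have e : energy Ω ν (u + ν • p : L2 Ω) v = energy Ω ν (u + ν • p : L2 Ω) hv2.toLp := by
      unfold energy
      rw [TV_congr hv2.coeFn_toLp]
      congr 2
      refine lintegral_congr_ae ?_
      filter_upwards [hv2.coeFn_toLp] with x hx
      rw [hx]
    rw [e]
    exact le_self_add.trans (energy_add_le hν h _)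

theorem IsMinimizer.eq_of_isSupport {Ω : Set (Euc N)} [IsFiniteMeasure (volume.restrict Ω)]
    {ν : ℝ} (hν : 0 < ν) {u p v : L2 Ω} (h : IsSupport (closure (divergences Ω)) u p)
    (hv : IsMinimizer Ω ν (u + ν • p) v) : v = u := by
  have h1 := (energy_add_le hν h v).trans (hv.le u (h.isMinimizer hν).memBV)
  rw [energy_eq hν.le h.inner_nonneg h.TV_eq] at h1
  have h2 : ENNReal.ofReal (2⁻¹ * ‖v - u‖ ^ 2) ≤ 0 :=
    (ENNReal.add_le_add_iff_left ENNReal.ofReal_ne_top).1 (by simpa using h1)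
  have h3 := ENNReal.ofReal_eq_zero.1 (le_zero_iff.1 h2)
  rw [← sub_eq_zero, ← norm_eq_zero, ← sq_eq_zero_iff]
  linarith [sq_nonneg ‖v - u‖]

theorem IsSupport.T_eq {Ω : Set (Euc N)} [IsFiniteMeasure (volume.restrict Ω)] {ν : ℝ}
    (hν : 0 < ν) {u p : L2 Ω} (h : IsSupport (closure (divergences Ω)) u p) :
    T Ω ν (u + ν • p) = u := by
  have hex : ∃ v, IsMinimizer Ω ν (u + ν • p) v := ⟨u, h.isMinimizer hν⟩
  rw [T, if_neg hν.ne', dif_pos hex]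
  exact IsMinimizer.eq_of_isSupport hν h hex.choose_spec

theorem exists_isSupport_T (Ω : Set (Euc N)) [IsFiniteMeasure (volume.restrict Ω)] {ν : ℝ}
    (hν : 0 < ν) (g : L2 Ω) :
    ∃ p, IsSupport (closure (divergences Ω)) (T Ω ν g) p ∧ g = T Ω ν g + ν • p := by
  obtain ⟨u, p, h, rfl⟩ := exists_isSupport_add_smul
    ⟨0, subset_closure (zero_mem_divergences Ω)⟩ isClosed_closure
    (convex_divergences Ω).closure hν g
  exact ⟨p, by rwa [h.T_eq hν], by rw [h.T_eq hν]⟩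

theorem continuous_T (Ω : Set (Euc N)) [IsFiniteMeasure (volume.restrict Ω)] {ν : ℝ}
    (hν : 0 < ν) : Continuous (T Ω ν) := by
  refine LipschitzWith.continuous (K := 1) (LipschitzWith.of_dist_le_mul fun g g' => ?_)
  obtain ⟨p, hp, hg⟩ := exists_isSupport_T Ω hν g
  obtain ⟨p', hp', hg'⟩ := exists_isSupport_T Ω hν g'
  rw [dist_eq_norm, dist_eq_norm, NNReal.coe_one, one_mul]
  refine (hp.norm_sub_le hp' hν.le).trans_eq ?_
  rw [← hg, ← hg']

theorem IsSupport.mem_subdiffTV {Ω : Set (Euc N)} {u p : L2 Ω}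
    (h : IsSupport (closure (divergences Ω)) u p) : p ∈ subdiffTV Ω u := by
  refine ⟨by rw [h.TV_eq]; simp, fun v => ?_⟩
  refine le_trans ?_ (EReal.coe_ennreal_le_coe_ennreal_iff.2 (ofReal_inner_le_TV v h.1))
  rw [h.TV_eq, EReal.coe_ennreal_ofReal, EReal.coe_ennreal_ofReal, max_eq_left h.inner_nonneg,
    ← EReal.coe_add, EReal.coe_le_coe_iff, inner_sub_right, real_inner_comm u p,
    real_inner_comm v p, add_sub_cancel]
  exact le_max_left _ _

/-- Let w + ν q be the Moreau decomposition of u + ν p. The subgradient inequality for p and the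
bound ⟪u, q⟫ ≤ TV(u) give 0 ≤ ⟪w - u, q - p⟫, which forces w = u. That p lies in the closure of the
divergences is not needed. -/
theorem eq_T_of_mem_subdiffTV {Ω : Set (Euc N)} [IsFiniteMeasure (volume.restrict Ω)] {ν : ℝ}
    (hν : 0 < ν) {u p : L2 Ω} (h : p ∈ subdiffTV Ω u) : u = T Ω ν (u + ν • p) := by
  obtain ⟨q, hq, hg⟩ := exists_isSupport_T Ω hν (u + ν • p)
  set w := T Ω ν (u + ν • p)
  have h1 := h.2 w
  rw [hq.TV_eq, ← ENNReal.ofReal_toReal h.1.ne, EReal.coe_ennreal_ofReal,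
    EReal.coe_ennreal_ofReal, ← EReal.coe_add, EReal.coe_le_coe_iff,
    max_eq_left ENNReal.toReal_nonneg, max_eq_left hq.inner_nonneg] at h1
  have h2 : inner ℝ u q ≤ (TV Ω u).toReal :=
    (ENNReal.ofReal_le_iff_le_toReal h.1.ne).1 (ofReal_inner_le_TV u hq.1)
  have h3 := norm_le_of_inner_nonneg hν.le (a := w - u) (b := q - p) (by
    simp only [inner_sub_left, inner_sub_right] at h1 ⊢
    rw [real_inner_comm p w, real_inner_comm p u]
    linarith)
  rw [show w - u + ν • (q - p) = (w + ν • q) - (u + ν • p) by rw [smul_sub]; abel, ← hg, sub_self,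
    norm_zero] at h3
  exact (sub_eq_zero.1 (norm_le_zero_iff.1 h3)).symm

/-! ### The flux of a field through a sphere. -/

theorem IsTestField.norm_le {Ω : Set (Euc N)} {φ : Euc N → Euc N} (hφ : IsTestField Ω φ)
    (x : Euc N) : ‖φ x‖ ≤ 1 := by
  by_cases hx : x ∈ Ω
  · exact hφ.norm_le_one x hx
  · rw [image_eq_zero_of_notMem_tsupport fun h => hx (hφ.support_subset h), norm_zero]
    exact zero_le_one

theorem fderiv_apply_coord {φ : Euc N → Euc N} {x : Euc N} (hφ : DifferentiableAt ℝ φ x)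
    (v : Euc N) (i : Fin N) : fderiv ℝ (fun y => φ y i) x v = fderiv ℝ φ x v i := by
  have h := ((EuclideanSpace.proj i : Euc N →L[ℝ] ℝ).hasFDerivAt
    (x := φ x)).comp x hφ.hasFDerivAt
  have e : (fun y => φ y i) = (EuclideanSpace.proj i : Euc N →L[ℝ] ℝ) ∘ φ := rfl
  rw [e, h.fderiv]
  rfl

/-- Integration by parts against a smooth compactly supported vector field. -/
theorem integral_mul_divergence {φ : Euc N → Euc N} (hφ : ContDiff ℝ ∞ φ)
    (hc : HasCompactSupport φ) {η : Euc N → ℝ} (hη : ContDiff ℝ ∞ η) :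
    ∫ x, η x * divergence φ x = -∫ x, fderiv ℝ η x (φ x) := by
  have dφ : Differentiable ℝ φ := hφ.differentiable (by simp)
  have cφ := hφ.continuous
  have cη := hη.continuous
  have cφ' := hφ.continuous_fderiv (by simp)
  have cη' := hη.continuous_fderiv (by simp)
  have coord : ∀ i, ContDiff ℝ ∞ fun y => φ y i := fun i =>
    (EuclideanSpace.proj i : Euc N →L[ℝ] ℝ).contDiff.comp hφ
  have i1 : ∀ i : Fin N, Integrable fun x =>
      fderiv ℝ η x (EuclideanSpace.single i 1) * φ x i := fun i => by
    refine Continuous.integrable_of_hasCompactSupport (by fun_prop) (hc.mono' ?_)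
    refine fun x hx => subset_tsupport _ fun h => hx ?_
    simp [h]
  have i2 : ∀ i : Fin N, Integrable fun x =>
      η x * fderiv ℝ (fun y => φ y i) x (EuclideanSpace.single i 1) := fun i => by
    simp only [fderiv_apply_coord (dφ _)]
    refine Continuous.integrable_of_hasCompactSupport (by fun_prop) ((hc.fderiv ℝ).mono' ?_)
    refine fun x hx => subset_tsupport _ fun h => hx ?_
    simp [h]
  have i3 : ∀ i : Fin N, Integrable fun x => η x * φ x i := fun i => by
    refine Continuous.integrable_of_hasCompactSupport (by fun_prop) (hc.mono' ?_)
    refine fun x hx => subset_tsupport _ fun h => hx ?_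
    simp [h]
  have e1 : ∀ x, η x * divergence φ x =
      ∑ i, η x * fderiv ℝ (fun y => φ y i) x (EuclideanSpace.single i 1) := fun x => by
    simp only [divergence, Finset.mul_sum, fderiv_apply_coord (dφ _)]
  have e2 : ∀ x, fderiv ℝ η x (φ x) =
      ∑ i, fderiv ℝ η x (EuclideanSpace.single i 1) * φ x i := fun x => by
    have : φ x = ∑ i, φ x i • EuclideanSpace.single i (1 : ℝ) := by
      ext j
      simp [Finset.sum_apply, Pi.single_apply]
    conv_lhs => rw [this, map_sum]
    simp [mul_comm]
  simp only [e1, e2]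
  rw [integral_finsetSum _ fun i _ => i2 i, integral_finsetSum _ fun i _ => i1 i,
    ← Finset.sum_neg_distrib]
  exact Finset.sum_congr rfl fun i _ => integral_mul_fderiv_eq_neg_fderiv_mul_of_integrable
    (i1 i) (i2 i) (i3 i) (fun x _ => hη.differentiable (by simp) x)
    (fun x _ => (coord i).differentiable (by simp) x)

theorem integral_divergence {φ : Euc N → Euc N} (hφ : ContDiff ℝ ∞ φ)
    (hc : HasCompactSupport φ) : ∫ x, divergence φ x = 0 := by
  simpa using integral_mul_divergence hφ hc (η := fun _ => 1) contDiff_const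

/-- The perimeter of the ball of radius `r` in `ℝ^N`. -/
noncomputable def perimeter (N : ℕ) (r : ℝ) : ℝ := N * (volume.real (Metric.ball (0 : Euc N) 1) * r ^ (N - 1))

theorem deriv_smoothTransition_nonneg (y : ℝ) : 0 ≤ deriv Real.smoothTransition y :=
  Real.smoothTransition.monotone.deriv_nonneg

theorem deriv_smoothTransition_of_nonpos {y : ℝ} (hy : y ≤ 0) :
    deriv Real.smoothTransition y = 0 :=
  IsLocalMin.deriv_eq_zero (Filter.Eventually.of_forall fun z => by
    rw [Real.smoothTransition.zero_of_nonpos hy]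
    exact Real.smoothTransition.nonneg z)

theorem hasDerivAt_smoothTransition (y : ℝ) :
    HasDerivAt Real.smoothTransition (deriv Real.smoothTransition y) y :=
  ((Real.smoothTransition.contDiff (n := 1)).differentiable (by simp) y).hasDerivAt

instance [NeZero N] : Nontrivial (Euc N) :=
  inferInstanceAs (Nontrivial (EuclideanSpace ℝ (Fin N)))

/-- The integrand is the length of the gradient of the cutoff `smoothTransition (s * (r ^ 2 - ‖x‖ ^
2))`. In polar coordinates it lives on radii at most `r`, where the weight is at most `r ^ (N - 1)`,
and the cutoff varies by at most one along a ray. -/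
theorem integral_radial_le [NeZero N] {r s : ℝ} (hr : 0 < r) (hs : 0 ≤ s) :
    ∫ x : Euc N, s * (2 * ‖x‖) * deriv Real.smoothTransition (s * (r ^ 2 - ‖x‖ ^ 2)) ≤
      perimeter N r := by
  set G : ℝ → ℝ := fun ρ => s * (2 * ρ) * deriv Real.smoothTransition (s * (r ^ 2 - ρ ^ 2))
    with hG
  have cd : Continuous (deriv Real.smoothTransition) :=
    (Real.smoothTransition.contDiff (n := 1)).continuous_deriv (by simp)
  have cG : Continuous G := by fun_prop
  have hd : ∀ ρ, HasDerivAt (fun ρ => -Real.smoothTransition (s * (r ^ 2 - ρ ^ 2))) (G ρ) ρ := by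
    intro ρ
    have h1 : HasDerivAt (fun ρ : ℝ => s * (r ^ 2 - ρ ^ 2)) (s * (-(2 * ρ))) ρ := by
      simpa using (((hasDerivAt_id ρ).pow 2).const_sub (r ^ 2)).const_mul s
    have h2 := ((hasDerivAt_smoothTransition (s * (r ^ 2 - ρ ^ 2))).comp ρ h1).neg
    refine h2.congr_deriv ?_
    simp only [hG]; ring
  have e : ∫ x : Euc N, G ‖x‖ = _ := integral_fun_norm_addHaar volume G
  change ∫ x : Euc N, G ‖x‖ ≤ _
  rw [e, finrank_euclideanSpace, Fintype.card_fin, nsmul_eq_mul, smul_eq_mul, perimeter]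
  gcongr
  have hsub : Set.Ioc 0 r ⊆ Set.Ioi (0 : ℝ) := fun x hx => hx.1
  rw [setIntegral_eq_of_subset_of_forall_sdiff_eq_zero measurableSet_Ioi hsub,
    ← intervalIntegral.integral_of_le hr.le]
  · calc ∫ y in (0 : ℝ)..r, y ^ (N - 1) • G y ≤ ∫ y in (0 : ℝ)..r, r ^ (N - 1) * G y := by
          refine intervalIntegral.integral_mono_on hr.le
            (Continuous.intervalIntegrable (by fun_prop) _ _)
            (Continuous.intervalIntegrable (by fun_prop) _ _) fun y hy => ?_
          rw [smul_eq_mul]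
          refine mul_le_mul_of_nonneg_right (pow_le_pow_left₀ hy.1 hy.2 _) ?_
          exact mul_nonneg (mul_nonneg hs (by linarith [hy.1])) (deriv_smoothTransition_nonneg _)
      _ = r ^ (N - 1) * Real.smoothTransition (s * r ^ 2) := by
          rw [intervalIntegral.integral_const_mul, intervalIntegral.integral_eq_sub_of_hasDerivAt
            (fun x _ => hd x) (cG.intervalIntegrable _ _)]
          simp [Real.smoothTransition.zero]
      _ ≤ r ^ (N - 1) := mul_le_of_le_one_right (by positivity) (Real.smoothTransition.le_one _)
  · rintro y ⟨hy, hy'⟩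
    have h0 : r < y := by
      by_contra h
      exact hy' ⟨hy, not_lt.1 h⟩
    simp only [hG]
    rw [deriv_smoothTransition_of_nonpos, mul_zero, smul_zero]
    exact mul_nonpos_of_nonneg_of_nonpos hs (by nlinarith)

theorem tendsto_smoothTransition {y : ℝ} :
    Filter.Tendsto (fun j : ℕ => Real.smoothTransition (j * y)) Filter.atTop
      (nhds (if 0 < y then 1 else 0)) := by
  split_ifs with hy
  · obtain ⟨j₀, hj₀⟩ := exists_nat_ge (1 / y)
    refine tendsto_const_nhds.congr' ?_
    filter_upwards [Filter.eventually_ge_atTop j₀] with j hj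
    rw [Real.smoothTransition.one_of_one_le]
    have : (j₀ : ℝ) ≤ j := by exact_mod_cast hj
    rw [div_le_iff₀ hy] at hj₀
    nlinarith
  · refine tendsto_const_nhds.congr fun j => ?_
    rw [Real.smoothTransition.zero_of_nonpos]
    exact mul_nonpos_of_nonneg_of_nonpos (by positivity) (not_lt.1 hy)

/-- The flux of a field of norm at most one through a sphere is at most the perimeter. -/
theorem setIntegral_divergence_ball_le [NeZero N] {φ : Euc N → Euc N} (hφ : ContDiff ℝ ∞ φ)
    (hc : HasCompactSupport φ) (h1 : ∀ x, ‖φ x‖ ≤ 1) {r : ℝ} (hr : 0 < r) :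
    ∫ x in Metric.ball 0 r, divergence φ x ≤ perimeter N r := by
  have cd : Continuous (deriv Real.smoothTransition) :=
    (Real.smoothTransition.contDiff (n := 1)).continuous_deriv (by simp)
  have hint : Integrable (divergence φ) :=
    (continuous_divergence hφ).integrable_of_hasCompactSupport (hasCompactSupport_divergence hc)
  -- These cutoffs converge pointwise to the indicator of the open ball. Integration by parts moves
  -- the derivative onto them, and the L¹ norms of their gradients are at most the perimeter.
  have smooth : ∀ j : ℕ, ContDiff ℝ ∞ fun x : Euc N =>
      Real.smoothTransition (j * (r ^ 2 - ‖x‖ ^ 2)) := fun j =>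
    Real.smoothTransition.contDiff.comp
      (contDiff_const.mul (contDiff_const.sub (contDiff_norm_sq ℝ)))
  have bound : ∀ j : ℕ, ∫ x : Euc N, Real.smoothTransition (j * (r ^ 2 - ‖x‖ ^ 2)) *
      divergence φ x ≤ perimeter N r := by
    intro j
    rw [integral_mul_divergence hφ hc (smooth j), ← integral_neg]
    have hder : ∀ x v : Euc N,
        fderiv ℝ (fun x : Euc N => Real.smoothTransition (j * (r ^ 2 - ‖x‖ ^ 2))) x v =
        deriv Real.smoothTransition (j * (r ^ 2 - ‖x‖ ^ 2)) * (-(j * (2 * inner ℝ x v))) := by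
      intro x v
      have h2 : HasFDerivAt (fun x : Euc N => (j : ℝ) * (r ^ 2 - ‖x‖ ^ 2)) _ x :=
        ((hasStrictFDerivAt_norm_sq x).hasFDerivAt.const_sub (r ^ 2)).const_mul (j : ℝ)
      have h3 := (hasDerivAt_smoothTransition (j * (r ^ 2 - ‖x‖ ^ 2))).comp_hasFDerivAt x h2
      rw [HasFDerivAt.fderiv (f := fun x : Euc N =>
        Real.smoothTransition (j * (r ^ 2 - ‖x‖ ^ 2))) h3]
      simp
    have hcφ := hφ.continuous
    have hcη := (smooth j).continuous_fderiv (by simp)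
    refine (integral_mono (Integrable.neg (Continuous.integrable_of_hasCompactSupport
      (hcη.clm_apply hcφ) (hc.mono' fun x hx => subset_tsupport _ fun h => hx (by simp [h]))))
      ?_ fun x => ?_).trans (integral_radial_le (N := N) hr j.cast_nonneg)
    · refine Continuous.integrable_of_hasCompactSupport (by fun_prop)
        (HasCompactSupport.of_support_subset_isCompact (isCompact_closedBall 0 r) fun x hx => ?_)
      by_contra h
      rw [mem_closedBall_zero_iff, not_le] at h
      refine hx ?_
      dsimp only
      rw [deriv_smoothTransition_of_nonpos, mul_zero]
      exact mul_nonpos_of_nonneg_of_nonpos j.cast_nonneg (by nlinarith)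
    · dsimp only [Pi.neg_apply]
      rw [hder]
      have h2 : inner ℝ x (φ x) ≤ ‖x‖ := (real_inner_le_norm _ _).trans
        (mul_le_of_le_one_right (norm_nonneg _) (h1 x))
      have h3 := deriv_smoothTransition_nonneg (j * (r ^ 2 - ‖x‖ ^ 2))
      have h4 := mul_le_mul_of_nonneg_left h2 (a := (j : ℝ) * 2) (by positivity)
      nlinarith [mul_le_mul_of_nonneg_right h4 h3]
  refine le_of_tendsto' (x := Filter.atTop) ?_ bound
  rw [← integral_indicator measurableSet_ball]
  refine tendsto_integral_of_dominated_convergence (fun x => ‖divergence φ x‖)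
    (fun j => ((smooth j).continuous.mul (continuous_divergence hφ)).aestronglyMeasurable)
    hint.norm (fun j => Filter.Eventually.of_forall fun x => ?_)
    (Filter.Eventually.of_forall fun x => ?_)
  · rw [norm_mul, Real.norm_of_nonneg (Real.smoothTransition.nonneg _)]
    exact mul_le_of_le_one_left (norm_nonneg _) (Real.smoothTransition.le_one _)
  · have h2 := (tendsto_smoothTransition (y := r ^ 2 - ‖x‖ ^ 2)).mul_const (divergence φ x)
    have : x ∈ Metric.ball (0 : Euc N) r ↔ 0 < r ^ 2 - ‖x‖ ^ 2 := by
      rw [mem_ball_zero_iff, sub_pos, sq_lt_sq₀ (norm_nonneg _) hr.le]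
    have e : (Metric.ball 0 r).indicator (divergence φ) x =
        (if 0 < r ^ 2 - ‖x‖ ^ 2 then 1 else 0) * divergence φ x := by
      split_ifs with h
      · rw [Set.indicator_of_mem (this.2 h), one_mul]
      · rw [Set.indicator_of_notMem fun h' => h (this.1 h'), zero_mul]
    rwa [e]

theorem abs_setIntegral_divergence_ball_le [NeZero N] {φ : Euc N → Euc N} (hφ : ContDiff ℝ ∞ φ)
    (hc : HasCompactSupport φ) (h1 : ∀ x, ‖φ x‖ ≤ 1) {r : ℝ} (hr : 0 < r) :
    |∫ x in Metric.ball 0 r, divergence φ x| ≤ perimeter N r := by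
  refine abs_le.2 ⟨?_, setIntegral_divergence_ball_le hφ hc h1 hr⟩
  have h := setIntegral_divergence_ball_le (φ := -φ) hφ.neg hc.neg (by simpa using h1) hr
  have e : ∀ x, divergence (-φ) x = -divergence φ x := fun x => by
    simpa using divergence_combination hφ hφ (-1) 0 x
  simp only [e, integral_neg] at h
  linarith

/-! ### Indicators of balls paired with divergences. -/

/-- The class in `L²(B(0, R))` of the indicator function of `B(0, r)`. -/
noncomputable def ballIndicator (N : ℕ) (R r : ℝ) : L2 (Metric.ball (0 : Euc N) R) :=
  indicatorConstLp 2 (measurableSet_ball : MeasurableSet (Metric.ball (0 : Euc N) r))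
    (((Measure.restrict_apply_le _ _).trans_lt measure_ball_lt_top).ne) (1 : ℝ)

theorem inner_ballIndicator {R r : ℝ} (hr : r ≤ R) (p : L2 (Metric.ball (0 : Euc N) R)) :
    inner ℝ (ballIndicator N R r) p = ∫ x in Metric.ball 0 r, p x := by
  rw [ballIndicator, MeasureTheory.L2.inner_indicatorConstLp_one,
    Measure.restrict_restrict measurableSet_ball,
    Set.inter_eq_left.2 (Metric.ball_subset_ball hr)]

theorem ballIndicator_coeFn (R r : ℝ) :
    ballIndicator N R r =ᵐ[volume.restrict (Metric.ball 0 R)]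
      fun x => if ‖x‖ < r then 1 else 0 := by
  filter_upwards [indicatorConstLp_coeFn (p := 2) (c := (1 : ℝ))
    (hs := (measurableSet_ball : MeasurableSet (Metric.ball (0 : Euc N) r)))
    (hμs := ((Measure.restrict_apply_le (Metric.ball (0 : Euc N) R) _).trans_lt
      measure_ball_lt_top).ne)] with x hx
  rw [ballIndicator, hx]
  by_cases h : ‖x‖ < r
  · rw [if_pos h, Set.indicator_of_mem (mem_ball_zero_iff.2 h)]
  · rw [if_neg h, Set.indicator_of_notMem fun h' => h (mem_ball_zero_iff.1 h')]

theorem ballIndicator_zero (R : ℝ) : ballIndicator N R 0 = 0 := by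
  refine Lp.ext ?_
  filter_upwards [ballIndicator_coeFn (N := N) R 0, Lp.coeFn_zero ℝ 2
    (volume.restrict (Metric.ball (0 : Euc N) R))] with x h1 h2
  rw [h1, h2, if_neg (norm_nonneg x).not_gt, Pi.zero_apply]

theorem volume_real_ball [NeZero N] {r : ℝ} (hr : 0 ≤ r) :
    volume.real (Metric.ball (0 : Euc N) r) =
      volume.real (Metric.ball (0 : Euc N) 1) * r ^ N := by
  rw [Measure.real, Measure.addHaar_ball _ _ hr, ENNReal.toReal_mul, mul_comm,
    ENNReal.toReal_ofReal (by positivity), finrank_euclideanSpace, Fintype.card_fin]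
  rfl

theorem inner_ballIndicator_ballIndicator [NeZero N] {R r s : ℝ} (h0 : 0 ≤ r) (hrs : r ≤ s)
    (hs : s ≤ R) : inner ℝ (ballIndicator N R r) (ballIndicator N R s) =
      volume.real (Metric.ball (0 : Euc N) 1) * r ^ N := by
  rw [inner_ballIndicator (hrs.trans hs), ← volume_real_ball h0]
  have h := ae_restrict_of_ae_restrict_of_subset
    (Metric.ball_subset_ball (hrs.trans hs)) (ballIndicator_coeFn (N := N) R s)
  have e : ∫ x in Metric.ball 0 r, ballIndicator N R s x =
      ∫ x in Metric.ball (0 : Euc N) r, (1 : ℝ) := by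
    refine integral_congr_ae ?_
    filter_upwards [h, ae_restrict_mem measurableSet_ball] with x hx hxr
    rw [hx, if_pos ((mem_ball_zero_iff.1 hxr).trans_le hrs)]
  rw [e]
  simp

theorem inner_ballIndicator_eq_of_ae {R r : ℝ} (hr : r ≤ R)
    {p : L2 (Metric.ball (0 : Euc N) R)} {f : Euc N → ℝ}
    (hp : p =ᵐ[volume.restrict (Metric.ball 0 R)] f) :
    inner ℝ (ballIndicator N R r) p = ∫ x in Metric.ball 0 r, f x := by
  rw [inner_ballIndicator hr]
  exact integral_congr_ae (ae_restrict_of_ae_restrict_of_subset (Metric.ball_subset_ball hr) hp)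

theorem abs_inner_ballIndicator_le [NeZero N] {R r : ℝ} (h0 : 0 < r) (hr : r ≤ R)
    {p : L2 (Metric.ball (0 : Euc N) R)} (hp : p ∈ closure (divergences (Metric.ball 0 R))) :
    |inner ℝ (ballIndicator N R r) p| ≤ perimeter N r := by
  refine closure_minimal (s := divergences (Metric.ball 0 R))
    (t := {p | |inner ℝ (ballIndicator N R r) p| ≤ perimeter N r}) ?_
    (isClosed_le (continuous_const.inner continuous_id).abs continuous_const) hp
  rintro p ⟨φ, hφ, hp⟩
  rw [Set.mem_ofPred_eq, inner_ballIndicator_eq_of_ae hr hp]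
  exact abs_setIntegral_divergence_ball_le hφ.smooth hφ.compactSupport hφ.norm_le h0

/-- A test field has compact support in the ball, so there is no flux through the boundary; the
identity passes to the closure. -/
theorem inner_ballIndicator_self_eq_zero {R : ℝ}
    {p : L2 (Metric.ball (0 : Euc N) R)} (hp : p ∈ closure (divergences (Metric.ball 0 R))) :
    inner ℝ (ballIndicator N R R) p = 0 := by
  refine closure_minimal (s := divergences (Metric.ball 0 R))
    (t := {p | inner ℝ (ballIndicator N R R) p = 0}) ?_
    (isClosed_eq (continuous_const.inner continuous_id) continuous_const) hp
  rintro p ⟨φ, hφ, hp⟩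
  rw [Set.mem_ofPred_eq, inner_ballIndicator_eq_of_ae le_rfl hp,
    setIntegral_eq_integral_of_forall_compl_eq_zero, integral_divergence hφ.smooth
    hφ.compactSupport]
  intro x hx
  have h : x ∉ tsupport φ := fun h => hx (hφ.support_subset h)
  simp [divergence, fderiv_of_notMem_tsupport ℝ h]

/-! ### Radial fields and their approximation by test fields. -/

/-- The radial vector field with profile `ρ ↦ ρ f ρ`. -/
noncomputable def radialField (f : ℝ → ℝ) (x : Euc N) : Euc N := f ‖x‖ • x

/-- A factor constant near zero makes the field linear near the origin, where the norm is not
smooth. -/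
theorem contDiff_radialField {f : ℝ → ℝ} (hf : ContDiff ℝ ∞ f) {δ : ℝ} (hδ : 0 < δ)
    (hc : ∀ ρ < δ, f ρ = f 0) : ContDiff ℝ ∞ (radialField (N := N) f) := by
  rw [contDiff_iff_contDiffAt]
  intro x
  by_cases hx : x = 0
  · have h : radialField f =ᶠ[nhds x] fun y : Euc N => f 0 • y := by
      rw [hx]
      filter_upwards [Metric.ball_mem_nhds (0 : Euc N) hδ] with y hy
      rw [radialField, hc _ (mem_ball_zero_iff.1 hy)]
    exact (contDiff_id.const_smul (f 0)).contDiffAt.congr_of_eventuallyEq h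
  · exact (hf.contDiffAt.comp x (contDiffAt_norm ℝ hx)).smul contDiffAt_id

theorem divergence_radialField {f : ℝ → ℝ} (hf : Differentiable ℝ f) {x : Euc N} (hx : x ≠ 0) :
    divergence (radialField f) x = N * f ‖x‖ + ‖x‖ * deriv f ‖x‖ := by
  have hpos := norm_pos_iff.2 hx
  have h1 : HasFDerivAt (fun y : Euc N => ‖y‖) (‖x‖⁻¹ • innerSL ℝ x) x := by
    have h := (hasStrictFDerivAt_norm_sq x).hasFDerivAt.sqrt (by positivity)
    simp only [Real.sqrt_sq (norm_nonneg _)] at h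
    have e : (1 / (2 * ‖x‖)) • 2 • innerSL ℝ x = ‖x‖⁻¹ • innerSL ℝ x := by
      rw [← Nat.cast_smul_eq_nsmul ℝ, smul_smul]
      congr 1
      push_cast
      field_simp
    rwa [e] at h
  have h2 := ((hf ‖x‖).hasDerivAt.comp_hasFDerivAt x h1).smul (hasFDerivAt_id x)
  have h3 : ∀ i : Fin N, (fderiv ℝ (radialField f) x (EuclideanSpace.single i 1)) i =
      f ‖x‖ + deriv f ‖x‖ * ‖x‖⁻¹ * x i ^ 2 := by
    intro i
    rw [HasFDerivAt.fderiv (f := radialField f) h2]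
    simp [EuclideanSpace.inner_single_right]
    ring
  have h4 : ∑ i, x i ^ 2 = ‖x‖ ^ 2 := by
    rw [EuclideanSpace.norm_sq_eq]
    simp
  simp only [divergence, h3, Finset.sum_add_distrib, ← Finset.mul_sum, h4]
  simp
  field_simp

theorem isTestField_radialField {f : ℝ → ℝ} (hf : ContDiff ℝ ∞ f) {δ : ℝ} (hδ : 0 < δ)
    (hc : ∀ ρ < δ, f ρ = f 0) {R r : ℝ} (hr : r < R) (h0 : ∀ ρ, r ≤ ρ → f ρ = 0)
    (h1 : ∀ ρ, 0 < ρ → ρ < R → |ρ * f ρ| ≤ 1) :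
    IsTestField (Metric.ball 0 R) (radialField (N := N) f) := by
  have hsupp : Function.support (radialField (N := N) f) ⊆ Metric.closedBall 0 r := by
    intro x hx
    by_contra h
    rw [mem_closedBall_zero_iff, not_le] at h
    exact hx (by rw [radialField, h0 _ h.le, zero_smul])
  refine ⟨contDiff_radialField hf hδ hc, .of_support_subset_isCompact (isCompact_closedBall 0 r)
    hsupp, (closure_minimal hsupp Metric.isClosed_closedBall).trans
    (Metric.closedBall_subset_ball hr), fun x hx => ?_⟩
  rw [radialField, norm_smul, Real.norm_eq_abs]
  rcases (norm_nonneg x).eq_or_lt with h | h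
  · rw [← h, mul_zero]; exact zero_le_one
  · have := h1 _ h (mem_ball_zero_iff.1 hx)
    rwa [abs_mul, abs_of_pos h, mul_comm] at this

theorem tendsto_of_tendsto_ae_of_bounded {Ω : Set (Euc N)} [IsFiniteMeasure (volume.restrict Ω)]
    {p : ℕ → L2 Ω} {v : L2 Ω} {C : ℝ} (hb : ∀ j, ∀ᵐ x ∂(volume.restrict Ω), |p j x| ≤ C)
    (hlim : ∀ᵐ x ∂(volume.restrict Ω), Filter.Tendsto (fun j => p j x) Filter.atTop (nhds (v x))) :
    Filter.Tendsto p Filter.atTop (nhds v) := by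
  rw [tendsto_iff_norm_sub_tendsto_zero]
  have key : Filter.Tendsto (fun j => ‖p j - v‖ ^ 2) Filter.atTop (nhds 0) := by
    have e : ∀ j, ‖p j - v‖ ^ 2 = ∫ x in Ω, (p j x - v x) * (p j x - v x) := fun j => by
      rw [← real_inner_self_eq_norm_sq, inner_eq_integral (Lp.coeFn_sub _ _)]
      refine integral_congr_ae ?_
      filter_upwards [Lp.coeFn_sub (p j) v] with x hx
      rw [hx, Pi.sub_apply]
    simp only [e]
    have hv : ∀ᵐ x ∂(volume.restrict Ω), |v x| ≤ C := by
      filter_upwards [ae_all_iff.2 hb, hlim] with x h1 h2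
      exact le_of_tendsto' h2.abs h1
    rw [← integral_zero (Euc N) ℝ (μ := volume.restrict Ω)]
    refine tendsto_integral_of_dominated_convergence (fun _ => (C + C) * (C + C)) (fun j => ?_)
      (integrable_const _) (fun j => ?_) ?_
    · exact ((Lp.aestronglyMeasurable _).sub (Lp.aestronglyMeasurable _)).mul
        ((Lp.aestronglyMeasurable _).sub (Lp.aestronglyMeasurable _))
    · filter_upwards [hb j, hv] with x h1 h2
      have h3 : |p j x - v x| ≤ C + C := (abs_sub _ _).trans (add_le_add h1 h2)
      rw [norm_mul, Real.norm_eq_abs]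
      exact mul_self_le_mul_self (abs_nonneg _) h3
    · filter_upwards [hlim] with x hx
      have h := (hx.sub_const (v x)).mul (hx.sub_const (v x))
      simpa using h
  have h := key.sqrt
  simpa [Real.sqrt_sq (norm_nonneg _)] using h

instance isFiniteMeasure_restrict_ball (R : ℝ) :
    IsFiniteMeasure (volume.restrict (Metric.ball (0 : Euc N) R)) :=
  ⟨by simpa using measure_ball_lt_top⟩

/-- Here `h` is the derivative of f(ρ) = ∫_R^ρ h, and N f + ρ f' is the divergence of f(‖x‖) x.
Integrating the smooth `H j` gives factors that are constant near zero and vanish near `R`, hence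
test fields after a small rescaling. -/
theorem mem_closure_divergences_of_profile [NeZero N] {R : ℝ} (hR : 0 < R) {h : ℝ → ℝ}
    {H : ℕ → ℝ → ℝ} {C δ : ℝ} (hδ : 0 < δ) {e : ℕ → ℝ} (he : ∀ j, 0 < e j)
    (smooth : ∀ j, ContDiff ℝ ∞ (H j)) (zero_left : ∀ j, ∀ ρ ≤ δ, H j ρ = 0)
    (zero_right : ∀ j ρ, R - e j ≤ ρ → H j ρ = 0) (bound : ∀ j ρ, |H j ρ| ≤ C)
    (lim : ∀ ρ < R, Filter.Tendsto (fun j => H j ρ) Filter.atTop (nhds (h ρ)))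
    (le_one : ∀ ρ, 0 < ρ → ρ < R → |ρ * ∫ t in R..ρ, h t| ≤ 1)
    {v : L2 (Metric.ball (0 : Euc N) R)}
    (hv : v =ᵐ[volume.restrict (Metric.ball 0 R)]
      fun x => N * (∫ t in R..‖x‖, h t) + ‖x‖ * h ‖x‖) :
    v ∈ closure (divergences (Metric.ball 0 R)) := by
  have hC : 0 ≤ C := (abs_nonneg _).trans (bound 0 0)
  have hbound : ∀ ρ < R, |h ρ| ≤ C := fun ρ hρ =>
    le_of_tendsto' (lim ρ hρ).abs fun j => bound j ρ
  have hne : ∀ᵐ t : ℝ, t ≠ R := by simp [ae_iff]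
  have hint : ∀ a b, a ≤ R → b ≤ R → IntervalIntegrable h volume a b := by
    intro a b ha hb
    have hlt : ∀ᵐ t ∂(volume.restrict (Set.uIoc a b)), t < R := by
      filter_upwards [ae_restrict_mem measurableSet_uIoc, ae_restrict_of_ae hne] with t h1 h2
      exact lt_of_le_of_ne (h1.2.trans (max_le ha hb)) h2
    rw [intervalIntegrable_iff]
    refine Integrable.mono' (g := fun _ => C) (intervalIntegrable_iff.1 intervalIntegrable_const) ?_ ?_
    · refine aestronglyMeasurable_of_tendsto_ae Filter.atTop
        (fun j => (smooth j).continuous.aestronglyMeasurable) ?_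
      filter_upwards [hlt] with t ht using lim t ht
    · filter_upwards [hlt] with t ht using hbound t ht
  have Hint : ∀ j a b, IntervalIntegrable (H j) volume a b := fun j a b =>
    (smooth j).continuous.intervalIntegrable a b
  set ε : ℕ → ℝ := fun j => ∫ t in (0 : ℝ)..R, |H j t - h t| with hε
  have ε_nonneg : ∀ j, 0 ≤ ε j := fun j =>
    intervalIntegral.integral_nonneg hR.le fun t _ => abs_nonneg _
  have ε_tendsto : Filter.Tendsto ε Filter.atTop (nhds 0) := by
    rw [← intervalIntegral.integral_zero (a := 0) (b := R) (μ := volume) (E := ℝ)]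
    refine intervalIntegral.tendsto_integral_filter_of_dominated_convergence (fun _ => C + C)
      (Filter.Eventually.of_forall fun j => ?_) (Filter.Eventually.of_forall fun j => ?_)
      (by simp) ?_
    · exact ((Hint j 0 R).sub (hint 0 R hR.le le_rfl)).abs.def'.aestronglyMeasurable
    · filter_upwards [hne] with t h1 h2
      rw [Set.uIoc_of_le hR.le] at h2
      rw [Real.norm_eq_abs, abs_abs]
      exact (abs_sub _ _).trans (add_le_add (bound j t) (hbound t (lt_of_le_of_ne h2.2 h1)))
    · filter_upwards [hne] with t h1 h2
      rw [Set.uIoc_of_le hR.le] at h2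
      simpa using ((lim t (lt_of_le_of_ne h2.2 h1)).sub_const (h t)).abs
  have close : ∀ j ρ, 0 ≤ ρ → ρ ≤ R → |(∫ t in R..ρ, H j t) - ∫ t in R..ρ, h t| ≤ ε j := by
    intro j ρ h0 h1
    rw [← intervalIntegral.integral_sub (Hint j R ρ) (hint R ρ le_rfl h1),
      intervalIntegral.integral_symm, abs_neg]
    refine (intervalIntegral.abs_integral_le_integral_abs h1).trans ?_
    refine intervalIntegral.integral_mono_interval h0 h1 le_rfl
      (Filter.Eventually.of_forall fun t => abs_nonneg _)
      ((Hint j 0 R).sub (hint 0 R hR.le le_rfl)).abs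
  -- The approximating fields may exceed norm one, by at most `R * ε j`; this factor restores the
  -- bound and tends to one.
  set s : ℕ → ℝ := fun j => (1 + R * ε j)⁻¹ with hs
  have s_pos : ∀ j, 0 < s j := fun j => by have := ε_nonneg j; positivity
  have s_le : ∀ j, s j ≤ 1 := fun j =>
    inv_le_one_of_one_le₀ (by linarith [mul_nonneg hR.le (ε_nonneg j)])
  have s_tendsto : Filter.Tendsto s Filter.atTop (nhds 1) := by
    have := ((ε_tendsto.const_mul R).const_add 1).inv₀ (by simp)
    simpa using this
  set f : ℕ → ℝ → ℝ := fun j ρ => s j * ∫ t in R..ρ, H j t with hf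
  have f_deriv : ∀ j ρ, HasDerivAt (f j) (s j * H j ρ) ρ := fun j ρ =>
    (intervalIntegral.integral_hasDerivAt_right (Hint j R ρ)
      (smooth j).continuous.stronglyMeasurable.stronglyMeasurableAtFilter
      (smooth j).continuous.continuousAt).const_mul _
  have f_diff : ∀ j, Differentiable ℝ (f j) := fun j ρ => (f_deriv j ρ).differentiableAt
  have f_smooth : ∀ j, ContDiff ℝ ∞ (f j) := fun j => by
    refine contDiff_infty_iff_deriv.2 ⟨f_diff j, ?_⟩
    rw [show deriv (f j) = fun ρ => s j * H j ρ from funext fun ρ => (f_deriv j ρ).deriv]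
    exact contDiff_const.mul (smooth j)
  have f_left : ∀ j, ∀ ρ < δ, f j ρ = f j 0 := fun j ρ hρ => by
    have : ∫ t in (0 : ℝ)..ρ, H j t = ∫ t in (0 : ℝ)..ρ, (0 : ℝ) :=
      intervalIntegral.integral_congr fun t ht =>
        zero_left j t (ht.2.trans (max_le hδ.le hρ.le))
    simp only [hf]
    rw [← intervalIntegral.integral_add_adjacent_intervals (Hint j R 0) (Hint j 0 ρ), this]
    simp
  have f_right : ∀ j ρ, R - e j ≤ ρ → f j ρ = 0 := fun j ρ hρ => by
    have : ∫ t in R..ρ, H j t = ∫ t in R..ρ, (0 : ℝ) :=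
      intervalIntegral.integral_congr fun t ht =>
        zero_right j t (le_trans (le_min (by linarith [he j]) hρ) ht.1)
    simp only [hf]
    rw [this]
    simp
  have f_le : ∀ j ρ, 0 < ρ → ρ < R → |ρ * f j ρ| ≤ 1 := fun j ρ h0 h1 => by
    have h2 : |ρ * ∫ t in R..ρ, H j t| ≤ 1 + R * ε j := by
      have h3 : ρ * (∫ t in R..ρ, H j t) = ρ * (∫ t in R..ρ, h t) +
        ρ * ((∫ t in R..ρ, H j t) - ∫ t in R..ρ, h t) := by ring
      rw [h3]
      refine (abs_add_le _ _).trans (add_le_add (le_one ρ h0 h1) ?_)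
      rw [abs_mul, abs_of_pos h0]
      exact mul_le_mul h1.le (close j ρ h0.le h1.le) (abs_nonneg _) hR.le
    have h4 : ρ * f j ρ = s j * (ρ * ∫ t in R..ρ, H j t) := by simp only [hf]; ring
    rw [h4, abs_mul, abs_of_pos (s_pos j)]
    have := ε_nonneg j
    exact (mul_le_mul_of_nonneg_left h2 (s_pos j).le).trans_eq
      (inv_mul_cancel₀ (by positivity))
  have test := fun j => isTestField_radialField (N := N) (f_smooth j) hδ (f_left j)
    (sub_lt_self R (he j)) (f_right j) (f_le j)
  choose p hp hpφ using fun j => exists_mem_divergences (test j)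
  have hx0 : ∀ᵐ x ∂(volume.restrict (Metric.ball (0 : Euc N) R)), x ≠ 0 :=
    ae_restrict_of_ae (by simp [ae_iff])
  have hpx : ∀ j, ∀ᵐ x ∂(volume.restrict (Metric.ball (0 : Euc N) R)),
      p j x = N * (s j * ∫ t in R..‖x‖, H j t) + ‖x‖ * (s j * H j ‖x‖) := fun j => by
    filter_upwards [hpφ j, hx0] with x h1 h2
    rw [h1, divergence_radialField (f_diff j) h2, (f_deriv j _).deriv]
  refine mem_closure_of_tendsto (f := p) (b := Filter.atTop) ?_ (Filter.Eventually.of_forall hp)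
  refine tendsto_of_tendsto_ae_of_bounded (C := N * (C * R) + R * C) (fun j => ?_) ?_
  · filter_upwards [hpx j, ae_restrict_mem measurableSet_ball] with x h1 h2
    rw [mem_ball_zero_iff] at h2
    have h3 : |∫ t in R..‖x‖, H j t| ≤ C * R := by
      refine (intervalIntegral.norm_integral_le_of_norm_le_const (f := H j)
        fun t _ => bound j t).trans (mul_le_mul_of_nonneg_left ?_ hC)
      rw [abs_sub_comm, abs_of_nonneg (by linarith)]
      linarith [norm_nonneg x]
    rw [h1]
    refine (abs_add_le _ _).trans (add_le_add ?_ ?_)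
    · rw [abs_mul, abs_mul, Nat.abs_cast, abs_of_pos (s_pos j)]
      exact mul_le_mul_of_nonneg_left ((mul_le_of_le_one_left (abs_nonneg _) (s_le j)).trans h3)
        (Nat.cast_nonneg _)
    · rw [abs_mul, abs_mul, abs_norm, abs_of_pos (s_pos j)]
      exact mul_le_mul h2.le ((mul_le_of_le_one_left (abs_nonneg _) (s_le j)).trans (bound j _))
        (mul_nonneg (s_pos j).le (abs_nonneg _)) hR.le
  · filter_upwards [ae_all_iff.2 hpx, hv, ae_restrict_mem measurableSet_ball] with x h1 h2 h3
    rw [mem_ball_zero_iff] at h3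
    simp only [h1, h2]
    have h4 : Filter.Tendsto (fun j => ∫ t in R..‖x‖, H j t) Filter.atTop
        (nhds (∫ t in R..‖x‖, h t)) := by
      rw [tendsto_iff_norm_sub_tendsto_zero]
      exact squeeze_zero (fun _ => norm_nonneg _) (fun j => close j _ (norm_nonneg _) h3.le)
        ε_tendsto
    have h5 := ((s_tendsto.mul h4).const_mul (N : ℝ)).add
      ((s_tendsto.mul (lim _ h3)).const_mul ‖x‖)
    simpa using h5

/-! ### Profiles of step functions. -/

/-- The derivative of the profile of the field whose divergence is the indicator function of the
ball of radius `r`. -/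
noncomputable def ballProfile (N : ℕ) (r ρ : ℝ) : ℝ := if ρ ≤ r then 0 else -(r ^ N / ρ ^ (N + 1))

theorem intervalIntegrable_ballProfile {r a b : ℝ} (hr : 0 < r) :
    IntervalIntegrable (ballProfile N r) volume a b := by
  rw [intervalIntegrable_iff]
  refine Integrable.mono' (g := fun _ => 1 / r)
    (intervalIntegrable_iff.1 intervalIntegrable_const) ?_ (Filter.Eventually.of_forall fun ρ => ?_)
  · refine (Measurable.ite measurableSet_Iic measurable_const ?_).aestronglyMeasurable
    fun_prop
  · rw [ballProfile, Real.norm_eq_abs]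
    split_ifs with h
    · rw [abs_zero]; positivity
    · have hρ : 0 < ρ := hr.trans (not_le.1 h)
      rw [abs_neg, abs_of_nonneg (by positivity), div_le_div_iff₀ (by positivity) hr, one_mul,
        ← pow_succ]
      exact pow_le_pow_left₀ hr.le (not_le.1 h).le _

/-- The subtracted constant comes from integrating from `R`; it cancels in combinations with zero
total integral. -/
theorem integral_ballProfile [NeZero N] {r R ρ : ℝ} (hr : 0 < r) (hrR : r ≤ R) (hρ : 0 < ρ)
    (hρR : ρ ≤ R) : ∫ t in R..ρ, ballProfile N r t =
      (min ρ r) ^ N / (N * ρ ^ N) - r ^ N / (N * R ^ N) := by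
  have hN : (N : ℝ) ≠ 0 := Nat.cast_ne_zero.2 (NeZero.ne N)
  have outer : ∀ ρ, r ≤ ρ → ρ ≤ R → ∫ t in R..ρ, ballProfile N r t =
      r ^ N / (N * ρ ^ N) - r ^ N / (N * R ^ N) := by
    intro ρ h1 h2
    have e : ∫ t in R..ρ, ballProfile N r t = ∫ t in R..ρ, -(r ^ N / t ^ (N + 1)) := by
      refine intervalIntegral.integral_congr_ae (Filter.Eventually.of_forall fun t ht => ?_)
      rw [Set.uIoc_of_ge h2] at ht
      rw [ballProfile, if_neg (h1.trans_lt ht.1).not_ge]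
    have hpos : ∀ t ∈ Set.uIcc R ρ, 0 < t := fun t ht => by
      rw [Set.uIcc_of_ge h2] at ht
      exact hr.trans_le (h1.trans ht.1)
    rw [e]
    refine intervalIntegral.integral_eq_sub_of_hasDerivAt (f := fun t => r ^ N / (N * t ^ N))
      (fun t ht => ?_) (ContinuousOn.intervalIntegrable fun t ht => ?_)
    · have ht0 := (hpos t ht).ne'
      have h3 := ((hasDerivAt_pow N t).const_mul (N : ℝ)).inv (by positivity)
      refine (h3.const_mul (r ^ N)).congr_deriv ?_
      have : t ^ N = t ^ (N - 1) * t := by rw [← pow_succ, Nat.sub_add_cancel (NeZero.pos N)]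
      rw [pow_succ, this]
      field_simp
      rw [pow_succ, this]
      ring
    · exact (continuousAt_const.div (continuousAt_id.pow _)
        (pow_ne_zero _ (hpos t ht).ne')).neg.continuousWithinAt
  rcases le_total r ρ with h | h
  · rw [min_eq_right h, outer ρ h hρR]
  · have e : ∫ t in r..ρ, ballProfile N r t = ∫ t in r..ρ, (0 : ℝ) := by
      refine intervalIntegral.integral_congr fun t ht => ?_
      rw [Set.uIcc_of_ge h] at ht
      exact if_pos ht.2
    rw [← intervalIntegral.integral_add_adjacent_intervals
      (intervalIntegrable_ballProfile (a := R) (b := r) hr) (intervalIntegrable_ballProfile hr),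
      outer r le_rfl hrR, e, min_eq_left h, intervalIntegral.integral_zero, add_zero]
    field_simp

/-- A smooth approximation of `ballProfile`, vanishing near the sphere of radius `R`. -/
noncomputable def smoothBallProfile (N : ℕ) (R r : ℝ) (j : ℕ) (ρ : ℝ) : ℝ :=
  -(Real.smoothTransition (j * (ρ - r)) * Real.smoothTransition ((j + 1) * (R - ρ) - 1) *
    (r ^ N / ρ ^ (N + 1)))

theorem smoothBallProfile_of_le {R r ρ : ℝ} (h : ρ ≤ r) (j : ℕ) :
    smoothBallProfile N R r j ρ = 0 := by
  rw [smoothBallProfile, Real.smoothTransition.zero_of_nonpos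
    (mul_nonpos_of_nonneg_of_nonpos j.cast_nonneg (by linarith))]
  simp

theorem smoothBallProfile_of_ge {R r ρ : ℝ} {j : ℕ} (h : R - 1 / (j + 1) ≤ ρ) :
    smoothBallProfile N R r j ρ = 0 := by
  have : ((j : ℝ) + 1) * (R - ρ) - 1 ≤ 0 := by
    have h1 : R - ρ ≤ 1 / ((j : ℝ) + 1) := by linarith
    rw [le_div_iff₀ (by positivity)] at h1
    linarith
  rw [smoothBallProfile, Real.smoothTransition.zero_of_nonpos this]
  simp

theorem contDiff_smoothBallProfile (R : ℝ) {r : ℝ} (hr : 0 < r) (j : ℕ) :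
    ContDiff ℝ ∞ (smoothBallProfile N R r j) := by
  rw [contDiff_iff_contDiffAt]
  intro ρ
  rcases lt_or_ge ρ r with h | h
  · refine (contDiffAt_const (c := (0 : ℝ))).congr_of_eventuallyEq ?_
    filter_upwards [Iio_mem_nhds h] with y hy using smoothBallProfile_of_le (le_of_lt hy) j
  · have hρ : ρ ^ (N + 1) ≠ 0 := pow_ne_zero _ (hr.trans_le h).ne'
    have h1 : ContDiff ℝ ∞ fun ρ : ℝ => Real.smoothTransition (j * (ρ - r)) :=
      Real.smoothTransition.contDiff.comp (by fun_prop)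
    have h2 : ContDiff ℝ ∞ fun ρ : ℝ => Real.smoothTransition ((j + 1) * (R - ρ) - 1) :=
      Real.smoothTransition.contDiff.comp (by fun_prop)
    exact ((h1.contDiffAt.mul h2.contDiffAt).mul
      (contDiffAt_const.div (contDiffAt_id.pow _) hρ)).neg

theorem abs_smoothBallProfile_le (R : ℝ) {r : ℝ} (hr : 0 < r) (j : ℕ) (ρ : ℝ) :
    |smoothBallProfile N R r j ρ| ≤ 1 / r := by
  rcases le_or_gt ρ r with h | h
  · rw [smoothBallProfile_of_le h, abs_zero]; positivity
  · have hρ : 0 < ρ := hr.trans h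
    have h1 : r ^ N / ρ ^ (N + 1) ≤ 1 / r := by
      rw [div_le_div_iff₀ (by positivity) hr, one_mul, ← pow_succ]
      exact pow_le_pow_left₀ hr.le h.le _
    rw [smoothBallProfile, abs_neg, abs_mul, abs_mul,
      abs_of_nonneg (Real.smoothTransition.nonneg _), abs_of_nonneg (Real.smoothTransition.nonneg _),
      abs_of_nonneg (by positivity : 0 ≤ r ^ N / ρ ^ (N + 1))]
    refine (mul_le_of_le_one_left (by positivity) ?_).trans h1
    exact mul_le_one₀ (Real.smoothTransition.le_one _) (Real.smoothTransition.nonneg _)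
      (Real.smoothTransition.le_one _)

theorem tendsto_smoothBallProfile {R r ρ : ℝ} (hρ : ρ < R) :
    Filter.Tendsto (fun j => smoothBallProfile N R r j ρ) Filter.atTop
      (nhds (ballProfile N r ρ)) := by
  have h1 := tendsto_smoothTransition (y := ρ - r)
  have h2 : Filter.Tendsto (fun j : ℕ => Real.smoothTransition ((j + 1) * (R - ρ) - 1))
      Filter.atTop (nhds 1) := by
    obtain ⟨j₀, hj₀⟩ := exists_nat_ge (2 / (R - ρ))
    refine tendsto_const_nhds.congr' ?_
    filter_upwards [Filter.eventually_ge_atTop j₀] with j hj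
    rw [Real.smoothTransition.one_of_one_le]
    have : (j₀ : ℝ) ≤ j := by exact_mod_cast hj
    rw [div_le_iff₀ (by linarith)] at hj₀
    nlinarith
  have h3 := ((h1.mul h2).mul_const (r ^ N / ρ ^ (N + 1))).neg
  have e : ballProfile N r ρ = -((if 0 < ρ - r then 1 else 0) * 1 * (r ^ N / ρ ^ (N + 1))) := by
    rw [ballProfile]
    split_ifs with h4 h5 h5
    · linarith
    · simp
    · simp
    · linarith
  rw [e]
  exact h3

theorem coeFn_sum_smul_ballIndicator {R : ℝ} {ι : Type*} (s : Finset ι) (b r : ι → ℝ) :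
    (∑ i ∈ s, b i • ballIndicator N R (r i) : L2 (Metric.ball (0 : Euc N) R))
      =ᵐ[volume.restrict (Metric.ball 0 R)]
      fun x => ∑ i ∈ s, b i * (if ‖x‖ < r i then 1 else 0) := by
  have h : ∀ᵐ x ∂(volume.restrict (Metric.ball (0 : Euc N) R)), ∀ i ∈ s,
      (b i • ballIndicator N R (r i)) x = b i * (if ‖x‖ < r i then 1 else 0) := by
    refine (ae_ball_iff s.countable_toSet).2 fun i _ => ?_
    filter_upwards [Lp.coeFn_smul (b i) (ballIndicator N R (r i)),
      ballIndicator_coeFn (N := N) R (r i)] with x h1 h2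
    rw [h1, Pi.smul_apply, h2, smul_eq_mul]
  filter_upwards [Lp.coeFn_finsetSum s fun i => b i • ballIndicator N R (r i), h] with x h1 h2
  rw [h1, Finset.sum_apply]
  exact Finset.sum_congr rfl h2

theorem inner_sum_smul_ballIndicator [NeZero N] {R ρ : ℝ} (h0 : 0 ≤ ρ) (hρ : ρ ≤ R) {ι : Type*}
    (s : Finset ι) (b r : ι → ℝ) (hr : ∀ i ∈ s, 0 < r i ∧ r i ≤ R) :
    inner ℝ (ballIndicator N R ρ) (∑ i ∈ s, b i • ballIndicator N R (r i)) =
      ∑ i ∈ s, b i * (volume.real (Metric.ball (0 : Euc N) 1) * (min ρ (r i)) ^ N) := by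
  rw [inner_sum]
  refine Finset.sum_congr rfl fun i hi => ?_
  rw [real_inner_smul_right]
  obtain ⟨h1, h2⟩ := hr i hi
  rcases le_total ρ (r i) with h | h
  · rw [inner_ballIndicator_ballIndicator h0 h h2, min_eq_left h]
  · rw [real_inner_comm, inner_ballIndicator_ballIndicator h1.le h hρ, min_eq_right h]

theorem volume_real_unit_ball_pos : 0 < volume.real (Metric.ball (0 : Euc N) 1) :=
  ENNReal.toReal_pos (Metric.measure_ball_pos _ _ one_pos).ne' measure_ball_lt_top.ne

/-- A radial step function belongs to the closure of the divergences of test fields if its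
integrals over balls are bounded by the perimeters. -/
theorem sum_smul_ballIndicator_mem_closure [NeZero N] {R : ℝ} (hR : 0 < R) {ι : Type*}
    (s : Finset ι) (b r : ι → ℝ) {δ : ℝ} (hδ : 0 < δ) (hr : ∀ i ∈ s, δ ≤ r i ∧ r i ≤ R)
    (hb : ∀ ρ, 0 < ρ → ρ < R → |inner ℝ (ballIndicator N R ρ)
      (∑ i ∈ s, b i • ballIndicator N R (r i))| ≤ perimeter N ρ)
    (h0 : inner ℝ (ballIndicator N R R) (∑ i ∈ s, b i • ballIndicator N R (r i)) = 0) :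
    ∑ i ∈ s, b i • ballIndicator N R (r i) ∈ closure (divergences (Metric.ball (0 : Euc N) R)) := by
  have hr0 : ∀ i ∈ s, 0 < r i ∧ r i ≤ R := fun i hi => ⟨hδ.trans_le (hr i hi).1, (hr i hi).2⟩
  have hω := volume_real_unit_ball_pos (N := N)
  have hN : (0 : ℝ) < N := Nat.cast_pos.2 (NeZero.pos N)
  rw [inner_sum_smul_ballIndicator hR.le le_rfl s b r hr0] at h0
  have h0' : ∑ i ∈ s, b i * r i ^ N = 0 := by
    have e : ∑ i ∈ s, b i * (volume.real (Metric.ball (0 : Euc N) 1) * (min R (r i)) ^ N) =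
        volume.real (Metric.ball (0 : Euc N) 1) * ∑ i ∈ s, b i * r i ^ N := by
      rw [Finset.mul_sum]
      refine Finset.sum_congr rfl fun i hi => ?_
      rw [min_eq_right (hr i hi).2]
      ring
    rw [e] at h0
    exact (mul_eq_zero.1 h0).resolve_left hω.ne'
  have hint : ∀ ρ, 0 < ρ → ρ ≤ R → ∫ t in R..ρ, ∑ i ∈ s, b i * ballProfile N (r i) t =
      ∑ i ∈ s, b i * ((min ρ (r i)) ^ N / (N * ρ ^ N)) := by
    intro ρ h1 h2
    rw [intervalIntegral.integral_finsetSum fun i hi =>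
      (intervalIntegrable_ballProfile (hr0 i hi).1).const_mul _]
    have e : ∀ i ∈ s, ∫ t in R..ρ, b i * ballProfile N (r i) t =
        b i * ((min ρ (r i)) ^ N / (N * ρ ^ N)) - (b i * r i ^ N) / (N * R ^ N) := fun i hi => by
      rw [intervalIntegral.integral_const_mul,
        integral_ballProfile (hr0 i hi).1 (hr0 i hi).2 h1 h2]
      ring
    rw [Finset.sum_congr rfl e, Finset.sum_sub_distrib, ← Finset.sum_div, h0', zero_div, sub_zero]
  refine mem_closure_divergences_of_profile hR (h := fun ρ => ∑ i ∈ s, b i * ballProfile N (r i) ρ)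
    (H := fun j ρ => ∑ i ∈ s, b i * smoothBallProfile N R (r i) j ρ)
    (C := ∑ i ∈ s, |b i| * (1 / r i)) hδ (e := fun j => 1 / ((j : ℝ) + 1))
    (fun j => by positivity)
    (fun j => ContDiff.sum fun i hi => contDiff_const.mul (contDiff_smoothBallProfile R (hr0 i hi).1 j))
    (fun j ρ hρ => Finset.sum_eq_zero fun i hi => by
      rw [smoothBallProfile_of_le (hρ.trans (hr i hi).1), mul_zero])
    (fun j ρ hρ => Finset.sum_eq_zero fun i _ => by rw [smoothBallProfile_of_ge hρ, mul_zero])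
    (fun j ρ => (Finset.abs_sum_le_sum_abs _ _).trans (Finset.sum_le_sum fun i hi => by
      rw [abs_mul]
      exact mul_le_mul_of_nonneg_left (abs_smoothBallProfile_le R (hr0 i hi).1 j ρ) (abs_nonneg _)))
    (fun ρ hρ => tendsto_finsetSum _ fun i _ => (tendsto_smoothBallProfile hρ).const_mul _)
    (fun ρ h1 h2 => ?_) ?_
  · have h3 := hb ρ h1 h2
    rw [inner_sum_smul_ballIndicator h1.le h2.le s b r hr0] at h3
    rw [hint ρ h1 h2.le]
    have hρN : ρ ^ N = ρ * ρ ^ (N - 1) := by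
      rw [← pow_succ', Nat.sub_add_cancel (NeZero.pos N)]
    -- Divergence theorem for a radial field: the integral over the ball is the perimeter times the
    -- radial component. So the assumed bound says that the field has norm at most one.
    have e : ∑ i ∈ s, b i * (volume.real (Metric.ball (0 : Euc N) 1) * (min ρ (r i)) ^ N) =
        perimeter N ρ * (ρ * ∑ i ∈ s, b i * ((min ρ (r i)) ^ N / (N * ρ ^ N))) := by
      rw [perimeter, Finset.mul_sum, Finset.mul_sum]
      refine Finset.sum_congr rfl fun i _ => ?_
      rw [hρN]
      field_simp
    have hp : 0 < perimeter N ρ := by unfold perimeter; positivity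
    rw [e, abs_mul, abs_of_pos hp] at h3
    exact le_of_mul_le_mul_left (by rwa [mul_one]) hp
  · have hx0 : ∀ᵐ x ∂(volume.restrict (Metric.ball (0 : Euc N) R)), x ≠ 0 :=
      ae_restrict_of_ae (by simp [ae_iff])
    -- The formula for the divergence can fail on the spheres where the profile derivative jumps;
    -- these are null sets.
    have hxr : ∀ᵐ x ∂(volume.restrict (Metric.ball (0 : Euc N) R)), ∀ i ∈ s, ‖x‖ ≠ r i := by
      refine (ae_ball_iff s.countable_toSet).2 fun i hi => ae_restrict_of_ae ?_
      rw [ae_iff]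
      simpa [Metric.sphere, dist_zero_right] using Measure.addHaar_sphere volume (0 : Euc N) (r i)
    filter_upwards [coeFn_sum_smul_ballIndicator s b r, hx0, hxr, ae_restrict_mem measurableSet_ball]
      with x h1 h2 h3 h4
    rw [mem_ball_zero_iff] at h4
    have h5 := norm_pos_iff.2 h2
    rw [h1, hint _ h5 h4.le, Finset.mul_sum, Finset.mul_sum, ← Finset.sum_add_distrib]
    refine Finset.sum_congr rfl fun i hi => ?_
    rw [ballProfile]
    rcases lt_or_gt_of_ne (h3 i hi) with h6 | h6
    · rw [if_pos h6, if_pos h6.le, min_eq_left h6.le]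
      field_simp
      simp
    · rw [if_neg h6.not_gt, if_neg h6.not_ge, min_eq_right h6.le]
      field_simp
      ring

/-! ### Density of step functions among radial functions. -/

/-- A function which is almost everywhere a function of the norm is almost everywhere a measurable
function of the norm. -/
theorem IsRadial.exists_measurable [NeZero N] {R : ℝ} {g : L2 (Metric.ball (0 : Euc N) R)}
    (hg : IsRadial (Metric.ball 0 R) g) :
    ∃ γ : ℝ → ℝ, Measurable γ ∧ g =ᵐ[volume.restrict (Metric.ball 0 R)] fun x => γ ‖x‖ := by
  obtain ⟨γ, hγ⟩ := hg
  rw [ae_restrict_iff' measurableSet_ball] at hγ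
  have hmeas : Measurable g := (Lp.stronglyMeasurable g).measurable
  have mp := (volume : Measure (Euc N)).measurePreserving_homeomorphUnitSphereProd
  have h1 : ∀ᵐ x : ({0}ᶜ : Set (Euc N)) ∂(volume.comap Subtype.val),
      (x : Euc N) ∈ Metric.ball 0 R → g x = γ ‖(x : Euc N)‖ :=
    (ae_restrict_iff_subtype (measurableSet_singleton _).compl).1 (ae_restrict_of_ae hγ)
  have h2 := (mp.symm (homeomorphUnitSphereProd (Euc N)).toMeasurableEquiv).quasiMeasurePreserving.ae
    h1
  have : (ae (volume : Measure (Euc N)).toSphere).NeBot :=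
    ae_neBot.2 (Measure.toSphere_ne_zero _)
  -- By Fubini in polar coordinates, along almost every ray `g` agrees with `γ` at almost every
  -- radius. Restricting the measurable representative of `g` to one such ray gives a measurable
  -- profile.
  obtain ⟨θ, hθ⟩ := (Measure.ae_ae_of_ae_prod h2).exists
  have hnorm : ‖(θ : Euc N)‖ = 1 := mem_sphere_zero_iff_norm.1 θ.2
  refine ⟨fun ρ => g (ρ • (θ : Euc N)), hmeas.comp (by fun_prop), ?_⟩
  have h3 := (Measure.quasiMeasurePreserving_snd.comp mp.quasiMeasurePreserving).ae hθ
  have h4 := (ae_restrict_iff_subtype (μ := (volume : Measure (Euc N)))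
    (measurableSet_singleton (0 : Euc N)).compl
    (p := fun x => ‖x‖ < R → g (‖x‖ • (θ : Euc N)) = γ ‖x‖)).2 (by
      filter_upwards [h3] with x hx hxR
      simpa [norm_smul, hnorm, hxR] using hx)
  rw [restrict_compl_singleton] at h4
  rw [Filter.EventuallyEq, ae_restrict_iff' measurableSet_ball]
  filter_upwards [h4, hγ] with x h5 h6 hx
  rw [h6 hx, h5 (mem_ball_zero_iff.1 hx)]

/-- The indicator functions of the balls whose radii divide `[0, R]` into `n` equal parts. -/
noncomputable def uniformChain (N : ℕ) (R : ℝ) (n k : ℕ) : L2 (Metric.ball (0 : Euc N) R) :=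
  ballIndicator N R (k * R / n)

theorem coeFn_step_uniformChain {R : ℝ} (hR : 0 < R) {n : ℕ} (hn : 0 < n) (a : ℕ → ℝ) :
    ⇑(step n (uniformChain N R n) a) =ᵐ[volume.restrict (Metric.ball 0 R)]
      fun x => a ⌊n * ‖x‖ / R⌋₊ := by
  have h : ∀ᵐ x ∂(volume.restrict (Metric.ball (0 : Euc N) R)), ∀ k : ℕ,
      (a k • (uniformChain N R n (k + 1) - uniformChain N R n k)) x =
        a k * ((if ‖x‖ < (k + 1 : ℕ) * R / n then 1 else 0) -
          (if ‖x‖ < k * R / n then 1 else 0)) := by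
    refine ae_all_iff.2 fun k => ?_
    filter_upwards [Lp.coeFn_smul (a k) (uniformChain N R n (k + 1) - uniformChain N R n k),
      Lp.coeFn_sub (uniformChain N R n (k + 1)) (uniformChain N R n k),
      ballIndicator_coeFn (N := N) R ((k + 1 : ℕ) * R / n),
      ballIndicator_coeFn (N := N) R (k * R / n)] with x h1 h2 h3 h4
    rw [h1, Pi.smul_apply, h2, Pi.sub_apply, uniformChain, uniformChain, h3, h4, smul_eq_mul]
  filter_upwards [h, Lp.coeFn_finsetSum (Finset.range n)
    fun k => a k • (uniformChain N R n (k + 1) - uniformChain N R n k),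
    ae_restrict_mem measurableSet_ball] with x h1 h2 h3
  rw [mem_ball_zero_iff] at h3
  have hn' : (0 : ℝ) < n := Nat.cast_pos.2 hn
  rw [step, h2, Finset.sum_apply]
  simp only [h1]
  have hlt : ∀ k : ℕ, ‖x‖ < k * R / n ↔ ⌊n * ‖x‖ / R⌋₊ < k := fun k => by
    rw [Nat.floor_lt (by positivity), lt_div_iff₀ hn', div_lt_iff₀ hR, mul_comm]
  simp only [hlt]
  rw [Finset.sum_eq_single ⌊n * ‖x‖ / R⌋₊]
  · simp
  · intro k _ hk
    rcases lt_or_gt_of_ne hk with h4 | h4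
    · rw [if_neg (by omega), if_neg (by omega)]; ring
    · rw [if_pos (by omega), if_pos (by omega)]; ring
  · intro h4
    refine absurd (Finset.mem_range.2 ?_) h4
    rw [Nat.floor_lt (by positivity), div_lt_iff₀ hR]
    exact mul_lt_mul_of_pos_left h3 hn'

/-- Radial functions are limits of radial step functions. -/
theorem IsRadial.mem_closure [NeZero N] {R : ℝ} (hR : 0 < R)
    {g : L2 (Metric.ball (0 : Euc N) R)} (hg : IsRadial (Metric.ball 0 R) g) :
    g ∈ closure {v | ∃ n, 0 < n ∧ ∃ a, v = step n (uniformChain N R n) a} := by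
  obtain ⟨γ, hγ, hgγ⟩ := hg.exists_measurable
  -- Two approximations: the profile by a bounded continuous `h`, in L² of the image of the measure
  -- under the norm, and then `h` by its samples at the inner radii of the annuli.
  rw [← closure_closure]
  refine Metric.mem_closure_iff.2 fun ε hε => ?_
  have nm : Measurable fun x : Euc N => ‖x‖ := measurable_norm
  have hmem : MemLp γ 2 ((volume.restrict (Metric.ball (0 : Euc N) R)).map fun x => ‖x‖) := by
    rw [memLp_map_measure_iff hγ.aestronglyMeasurable nm.aemeasurable]
    exact (memLp_congr_ae hgγ).1 (Lp.memLp g)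
  obtain ⟨h, hle, hmem'⟩ := hmem.exists_boundedContinuous_eLpNorm_sub_le (by simp)
    (ε := ENNReal.ofReal (ε / 2)) (by simpa using hε)
  rw [memLp_map_measure_iff h.continuous.aestronglyMeasurable nm.aemeasurable] at hmem'
  rw [eLpNorm_map_measure (hγ.sub h.continuous.measurable).aestronglyMeasurable nm.aemeasurable]
    at hle
  refine ⟨hmem'.toLp, ?_, ?_⟩
  · refine mem_closure_of_tendsto (b := Filter.atTop)
      (f := fun n : ℕ => step (n + 1) (uniformChain N R (n + 1))
        fun k => h (k * R / ((n + 1 : ℕ) : ℝ))) ?_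
      (Filter.Eventually.of_forall fun n => ⟨n + 1, n.succ_pos, _, rfl⟩)
    refine tendsto_of_tendsto_ae_of_bounded (C := ‖h‖) (fun n => ?_) ?_
    · filter_upwards [coeFn_step_uniformChain (N := N) hR n.succ_pos
        fun k => h (k * R / ((n + 1 : ℕ) : ℝ))] with x hx
      rw [hx]
      exact h.norm_coe_le_norm _
    · filter_upwards [ae_all_iff.2 fun n : ℕ => coeFn_step_uniformChain (N := N) hR n.succ_pos
        fun k => h (k * R / ((n + 1 : ℕ) : ℝ)), hmem'.coeFn_toLp] with x h1 h2
      rw [h2]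
      simp only [h1]
      refine (h.continuous.tendsto ‖x‖).comp ?_
      have h3 : Filter.Tendsto (fun n : ℕ => ‖x‖ - R / ((n + 1 : ℕ) : ℝ)) Filter.atTop
          (nhds ‖x‖) := by
        have h4 := ((tendsto_const_div_atTop_nhds_zero_nat R).comp
          (Filter.tendsto_add_atTop_nat 1)).const_sub ‖x‖
        simpa using h4
      refine tendsto_of_tendsto_of_tendsto_of_le_of_le h3 tendsto_const_nhds (fun n => ?_)
        fun n => ?_
      · have hn : (0 : ℝ) < ((n + 1 : ℕ) : ℝ) := by positivity
        have h5 := Nat.lt_floor_add_one (((n + 1 : ℕ) : ℝ) * ‖x‖ / R)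
        rw [div_lt_iff₀ hR] at h5
        change ‖x‖ - R / ((n + 1 : ℕ) : ℝ) ≤ _
        rw [sub_le_iff_le_add, ← add_div, le_div_iff₀ hn]
        nlinarith
      · have hn : (0 : ℝ) < ((n + 1 : ℕ) : ℝ) := by positivity
        have h5 := Nat.floor_le (a := ((n + 1 : ℕ) : ℝ) * ‖x‖ / R) (by positivity)
        rw [le_div_iff₀ hR] at h5
        change _ / ((n + 1 : ℕ) : ℝ) ≤ ‖x‖
        rw [div_le_iff₀ hn]
        linarith
  · have e : ⇑(g - hmem'.toLp) =ᵐ[volume.restrict (Metric.ball 0 R)] (γ - ⇑h) ∘ fun x => ‖x‖ := by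
      filter_upwards [Lp.coeFn_sub g hmem'.toLp, hgγ, hmem'.coeFn_toLp] with x h1 h2 h3
      rw [h1, Pi.sub_apply, h2, h3]
      rfl
    rw [dist_eq_norm, Lp.norm_def, eLpNorm_congr_ae e]
    refine (ENNReal.toReal_mono ENNReal.ofReal_ne_top hle).trans_lt ?_
    rw [ENNReal.toReal_ofReal (by positivity)]
    linarith

/-! ### Concavity of the perimeter in the volume, and the chain of balls. -/

theorem perimeter_eq_rpow [NeZero N] {r : ℝ} (hr : 0 ≤ r) : perimeter N r =
    N * volume.real (Metric.ball (0 : Euc N) 1) * (r ^ N) ^ (((N : ℝ) - 1) / N) := by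
  have hN : (N : ℝ) ≠ 0 := Nat.cast_ne_zero.2 (NeZero.ne N)
  rw [perimeter, ← Real.rpow_natCast r N, ← Real.rpow_mul hr, mul_div_cancel₀ _ hN,
    ← Nat.cast_pred (NeZero.pos N), Real.rpow_natCast, mul_assoc]

theorem concaveOn_rpow_sub_one_div [NeZero N] :
    ConcaveOn ℝ (Set.Ici 0) fun τ : ℝ => τ ^ (((N : ℝ) - 1) / N) := by
  have hN : (1 : ℝ) ≤ N := by exact_mod_cast NeZero.one_le (n := N)
  exact Real.concaveOn_rpow (div_nonneg (by linarith) (by linarith))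
    ((div_le_one (by linarith)).2 (by linarith))

theorem perimeter_nonneg {r : ℝ} (hr : 0 ≤ r) : 0 ≤ perimeter N r := by
  unfold perimeter
  positivity

/-- Perimeters are concave as a function of the enclosed volume. -/
theorem le_perimeter_of_pow_eq [NeZero N] {r s ρ θ : ℝ} (hr : 0 ≤ r) (hs : 0 ≤ s) (hρ : 0 ≤ ρ)
    (h0 : 0 ≤ θ) (h1 : θ ≤ 1) (h : ρ ^ N = (1 - θ) * r ^ N + θ * s ^ N) :
    (1 - θ) * perimeter N r + θ * perimeter N s ≤ perimeter N ρ := by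
  have hc := (concaveOn_rpow_sub_one_div (N := N)).2 (x := r ^ N) (y := s ^ N)
    (Set.mem_Ici.2 (by positivity)) (Set.mem_Ici.2 (by positivity)) (sub_nonneg.2 h1) h0 (by ring)
  simp only [smul_eq_mul] at hc
  rw [← h] at hc
  rw [perimeter_eq_rpow hr, perimeter_eq_rpow hs, perimeter_eq_rpow hρ]
  have := mul_le_mul_of_nonneg_left hc
    (a := N * volume.real (Metric.ball (0 : Euc N) 1)) (by positivity)
  linarith

/-- The integral of a step function over a ball is an affine function of the volume of the ball
between two consecutive radii. -/
theorem inner_ballIndicator_step_uniformChain [NeZero N] {R : ℝ} (hR : 0 < R) {n k : ℕ}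
    (hk : k < n) {ρ θ : ℝ} (h1 : k * R / n ≤ ρ) (h2 : ρ ≤ (k + 1 : ℕ) * R / n)
    (h : ρ ^ N = (1 - θ) * (k * R / n) ^ N + θ * ((k + 1 : ℕ) * R / n) ^ N) (a : ℕ → ℝ) :
    inner ℝ (ballIndicator N R ρ) (step n (uniformChain N R n) a) =
      (1 - θ) * inner ℝ (uniformChain N R n k) (step n (uniformChain N R n) a) +
        θ * inner ℝ (uniformChain N R n (k + 1)) (step n (uniformChain N R n) a) := by
  have hn : (0 : ℝ) < n := Nat.cast_pos.2 (by omega)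
  have hmono : ∀ i j : ℕ, i ≤ j → (i : ℝ) * R / n ≤ j * R / n := fun i j hij => by gcongr
  have hle : ∀ j ≤ n, (j : ℝ) * R / n ≤ R := fun j hj => by
    have := hmono j n hj
    rwa [mul_div_cancel_left₀ _ hn.ne'] at this
  have key : ∀ j ≤ n, inner ℝ (ballIndicator N R ρ) (uniformChain N R n j) =
      (1 - θ) * inner ℝ (uniformChain N R n k) (uniformChain N R n j) +
        θ * inner ℝ (uniformChain N R n (k + 1)) (uniformChain N R n j) := by
    intro j hj
    unfold uniformChain
    rcases le_or_gt j k with hjk | hjk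
    · rw [real_inner_comm, inner_ballIndicator_ballIndicator (by positivity)
        ((hmono j k hjk).trans h1) (h2.trans (hle _ hk)),
        real_inner_comm, inner_ballIndicator_ballIndicator (by positivity)
        (hmono j k hjk) (hle _ hk.le),
        real_inner_comm, inner_ballIndicator_ballIndicator (by positivity)
        (hmono j (k + 1) (by omega)) (hle _ hk)]
      ring
    · rw [inner_ballIndicator_ballIndicator (le_trans (by positivity) h1)
        (h2.trans (hmono _ _ hjk)) (hle j hj), inner_ballIndicator_ballIndicator (by positivity)
        (hmono _ _ hjk.le) (hle _ hj), inner_ballIndicator_ballIndicator (by positivity)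
        (hmono _ _ hjk) (hle _ hj), h]
      ring
  simp only [step, inner_sum, real_inner_smul_right, inner_sub_right, Finset.mul_sum,
    ← Finset.sum_add_distrib]
  refine Finset.sum_congr rfl fun j hj => ?_
  have := Finset.mem_range.1 hj
  rw [key j (by omega), key (j + 1) (by omega)]
  ring

/-- Between grid radii the integral is affine in the volume and the perimeter is concave, so bounds
at the grid radii suffice. -/
theorem abs_inner_ballIndicator_step_le [NeZero N] {R : ℝ} (hR : 0 < R) {n : ℕ} (hn : 0 < n)
    {a : ℕ → ℝ} (ha : ∀ k ≤ n, |inner ℝ (uniformChain N R n k) (step n (uniformChain N R n) a)| ≤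
      perimeter N (k * R / n)) {ρ : ℝ} (h0 : 0 < ρ) (hρ : ρ < R) :
    |inner ℝ (ballIndicator N R ρ) (step n (uniformChain N R n) a)| ≤ perimeter N ρ := by
  have hn' : (0 : ℝ) < n := Nat.cast_pos.2 hn
  set k := ⌊n * ρ / R⌋₊ with hk
  have hkn : k < n := by
    rw [hk, Nat.floor_lt (by positivity), div_lt_iff₀ hR]
    exact mul_lt_mul_of_pos_left hρ hn'
  have h1 : k * R / n ≤ ρ := by
    have := Nat.floor_le (a := n * ρ / R) (by positivity)
    rw [le_div_iff₀ hR] at this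
    rw [div_le_iff₀ hn']
    linarith
  have h2 : ρ < (k + 1 : ℕ) * R / n := by
    have := Nat.lt_floor_add_one (n * ρ / R)
    rw [div_lt_iff₀ hR] at this
    rw [lt_div_iff₀ hn']
    push_cast
    linarith
  have hk0 : (0 : ℝ) ≤ k * R / n := by positivity
  have h3 : (k * R / n) ^ N ≤ ρ ^ N := pow_le_pow_left₀ hk0 h1 N
  -- Up to the volume of the unit ball, `N`-th powers of radii are volumes; θ below is the relative
  -- position of ρ in volume, not in radius.
  have h4 : ρ ^ N < ((k + 1 : ℕ) * R / n) ^ N := pow_lt_pow_left₀ h2 h0.le (NeZero.ne N)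
  set A := (k * R / n) ^ N with hA
  set B := ((k + 1 : ℕ) * R / n) ^ N with hB
  have hBA : 0 < B - A := by linarith
  set θ := (ρ ^ N - A) / (B - A) with hθ
  have t0 : 0 ≤ θ := div_nonneg (by linarith) hBA.le
  have t1 : θ ≤ 1 := (div_le_one hBA).2 (by linarith)
  have hθA : ρ ^ N = (1 - θ) * A + θ * B := by
    have : θ * (B - A) = ρ ^ N - A := div_mul_cancel₀ _ hBA.ne'
    linarith
  rw [inner_ballIndicator_step_uniformChain hR hkn h1 h2.le hθA]
  refine le_trans ?_ (le_perimeter_of_pow_eq hk0 (by positivity) h0.le t0 t1 hθA)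
  refine (abs_add_le _ _).trans (add_le_add ?_ ?_)
  · rw [abs_mul, abs_of_nonneg (sub_nonneg.2 t1)]
    exact mul_le_mul_of_nonneg_left (ha k hkn.le) (sub_nonneg.2 t1)
  · rw [abs_mul, abs_of_nonneg t0]
    exact mul_le_mul_of_nonneg_left (ha (k + 1) hkn) t0

/-- Abel summation passes from annuli to balls, whose coefficients are the jumps; the outermost ball
keeps the full last value. -/
theorem step_succ_eq_sum {H : Type*} [NormedAddCommGroup H] [InnerProductSpace ℝ H] {x : ℕ → H}
    (hx : x 0 = 0) (a : ℕ → ℝ) (m : ℕ) : step (m + 1) x a =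
      ∑ k ∈ Finset.range (m + 1), (if k < m then a k - a (k + 1) else a k) • x (k + 1) := by
  have key : step (m + 1) x a =
      ∑ k ∈ Finset.range m, (a k - a (k + 1)) • x (k + 1) + a m • x (m + 1) := by
    induction m with
    | zero => simp [step, hx]
    | succ m ih =>
      rw [step, Finset.sum_range_succ, ← step, ih, Finset.sum_range_succ, sub_smul, smul_sub]
      abel
  rw [key, Finset.sum_range_succ, if_neg (lt_irrefl m)]
  congr 1
  exact Finset.sum_congr rfl fun k hk => by rw [if_pos (Finset.mem_range.1 hk)]

theorem isConcaveChain_uniformChain (hN : 2 ≤ N) {R : ℝ} (hR : 0 < R) {n : ℕ} (hn : 0 < n) :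
    IsConcaveChain (closure (divergences (Metric.ball (0 : Euc N) R))) n (uniformChain N R n)
      (fun k => volume.real (Metric.ball (0 : Euc N) 1) * (k * R / n) ^ N)
      (fun k => perimeter N (k * R / n)) := by
  have : NeZero N := ⟨by omega⟩
  have hn' : (0 : ℝ) < n := Nat.cast_pos.2 hn
  have hω := volume_real_unit_ball_pos (N := N)
  have hmono : ∀ i j : ℕ, i ≤ j → (i : ℝ) * R / n ≤ j * R / n := fun i j hij => by gcongr
  have hnR : (n : ℝ) * R / n = R := mul_div_cancel_left₀ _ hn'.ne'
  have hle : ∀ j ≤ n, (j : ℝ) * R / n ≤ R := fun j hj => (hmono j n hj).trans_eq hnR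
  have hpow : ∀ k : ℕ, ((k : ℝ) * R / n) ^ N < ((k + 1 : ℕ) * R / n) ^ N := fun k => by
    refine pow_lt_pow_left₀ ?_ (by positivity) (NeZero.ne N)
    gcongr
    exact k.lt_succ_self
  have hzero : uniformChain N R n 0 = 0 := by
    rw [uniformChain, Nat.cast_zero, zero_mul, zero_div, ballIndicator_zero]
  refine ⟨fun k _ => mul_lt_mul_of_pos_left (hpow k) hω, hzero, fun j k hjk hk =>
    inner_ballIndicator_ballIndicator (by positivity) (hmono j k hjk) (hle k hk),
    fun k _ => ?_, fun p hp k hk => ?_, fun p hp => ?_, fun a ha hlast => ?_⟩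
  · have hs := (concaveOn_rpow_sub_one_div (N := N)).slope_anti_adjacent
      (Set.mem_Ici.2 (by positivity)) (Set.mem_Ici.2 (by positivity)) (hpow k) (hpow (k + 1))
    have e : ∀ i j : ℕ, (perimeter N (i * R / n) - perimeter N (j * R / n)) /
        (volume.real (Metric.ball (0 : Euc N) 1) * (i * R / n) ^ N -
          volume.real (Metric.ball (0 : Euc N) 1) * (j * R / n) ^ N) =
        N * (((((i : ℝ) * R / n) ^ N) ^ (((N : ℝ) - 1) / N) -
          (((j : ℝ) * R / n) ^ N) ^ (((N : ℝ) - 1) / N)) /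
            (((i : ℝ) * R / n) ^ N - ((j : ℝ) * R / n) ^ N)) := fun i j => by
      rw [perimeter_eq_rpow (by positivity), perimeter_eq_rpow (by positivity), ← mul_sub,
        ← mul_sub, mul_comm (N : ℝ), mul_assoc, mul_div_mul_left _ _ hω.ne', mul_div_assoc]
    rw [e, e]
    exact mul_le_mul_of_nonneg_left hs N.cast_nonneg
  · rcases k.eq_zero_or_pos with rfl | hk0
    · rw [hzero, inner_zero_left, abs_zero]
      exact perimeter_nonneg (by positivity)
    · have : (0 : ℝ) < k := Nat.cast_pos.2 hk0
      exact abs_inner_ballIndicator_le (by positivity) (hle k hk) hp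
  · rw [uniformChain, hnR]
    exact inner_ballIndicator_self_eq_zero hp
  · have hb := fun ρ h0 h1 => abs_inner_ballIndicator_step_le hR hn ha (ρ := ρ) h0 h1
    rw [uniformChain, hnR] at hlast
    obtain ⟨m, rfl⟩ : ∃ m, n = m + 1 := ⟨n - 1, by omega⟩
    -- Written with balls, the smallest radius is R/(m + 1) > 0, which serves as δ.
    rw [step_succ_eq_sum hzero] at hb hlast ⊢
    refine sum_smul_ballIndicator_mem_closure hR (Finset.range (m + 1)) _
      (fun k => (k + 1 : ℕ) * R / (m + 1 : ℕ)) (δ := 1 * R / (m + 1 : ℕ)) (by positivity)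
      (fun k hk => ⟨?_, hle _ (Finset.mem_range.1 hk)⟩) hb hlast
    simpa using hmono 1 (k + 1) (by omega)

/-- Both sides are continuous in `g`, so it is enough to treat step functions on uniform chains. -/
theorem T_semigroup (hN : 2 ≤ N) {R : ℝ} (hR : 0 < R) {g : L2 (Metric.ball (0 : Euc N) R)}
    (hg : IsRadial (Metric.ball 0 R) g) {lam ν : ℝ} (hlam : 0 < lam) (hν : 0 < ν) :
    T (Metric.ball 0 R) (lam + ν) g = T (Metric.ball 0 R) ν (T (Metric.ball 0 R) lam g) := by
  have : NeZero N := ⟨by omega⟩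
  refine closure_minimal (t := {g : L2 (Metric.ball (0 : Euc N) R) |
    T (Metric.ball 0 R) (lam + ν) g = T (Metric.ball 0 R) ν (T (Metric.ball 0 R) lam g)})
    ?_ (isClosed_eq (continuous_T _ (by linarith))
      ((continuous_T _ hν).comp (continuous_T _ hlam))) (hg.mem_closure hR)
  rintro _ ⟨n, hn, b, rfl⟩
  obtain ⟨p, hp, hgp⟩ := exists_isSupport_T (Metric.ball 0 R) hlam
    (step n (uniformChain N R n) b)
  obtain ⟨q, hq, huq⟩ := exists_isSupport_T (Metric.ball 0 R) hν
    (T (Metric.ball 0 R) lam (step n (uniformChain N R n) b))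
  obtain ⟨r, hr, hgr⟩ := (isConcaveChain_uniformChain hN hR hn).isSupport_semigroup
    (convex_divergences _).closure hlam hν hp hgp hq huq
  rw [Set.mem_ofPred_eq]
  conv_lhs => rw [hgr]
  exact hr.T_eq (by linarith)

end ROF

theorem mainTheorem4 (N : ℕ) (hN : 2 ≤ N) (R : ℝ) (hR : 0 < R) :
    -- the operators are well defined: for positive parameter, the minimizer exists and is unique
    (∀ (ν : ℝ), 0 < ν → ∀ h : ROF.L2 (Metric.ball (0 : ROF.Euc N) R),
      ROF.IsMinimizer (Metric.ball 0 R) ν h (ROF.T (Metric.ball 0 R) ν h) ∧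
      ∀ u, ROF.IsMinimizer (Metric.ball 0 R) ν h u → u = ROF.T (Metric.ball 0 R) ν h) ∧
    -- they are the resolvents `(I + ν ∂TV)⁻¹`
    (∀ (ν : ℝ), 0 < ν → ∀ h u : ROF.L2 (Metric.ball (0 : ROF.Euc N) R),
      u = ROF.T (Metric.ball 0 R) ν h ↔
        ∃ p ∈ ROF.subdiffTV (Metric.ball 0 R) u, h = u + ν • p) ∧
    -- the semigroup property for radial data
    (∀ g : ROF.L2 (Metric.ball (0 : ROF.Euc N) R), ROF.IsRadial (Metric.ball 0 R) g →
      ∀ lam mu : ℝ, 0 ≤ lam → lam < mu →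
        ROF.T (Metric.ball 0 R) mu g =
          ROF.T (Metric.ball 0 R) (mu - lam) (ROF.T (Metric.ball 0 R) lam g)) := by
  refine ⟨fun ν hν h => ?_, fun ν hν h u => ⟨?_, ?_⟩, fun g hg lam mu hlam hmu => ?_⟩
  · obtain ⟨p, hp, hg⟩ := ROF.exists_isSupport_T (Metric.ball 0 R) hν h
    have h1 := hp.isMinimizer hν
    have h2 := fun u hu => ROF.IsMinimizer.eq_of_isSupport hν hp (v := u) hu
    rw [← hg] at h1 h2
    exact ⟨h1, h2⟩
  · rintro rfl
    obtain ⟨p, hp, hg⟩ := ROF.exists_isSupport_T (Metric.ball 0 R) hν h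
    exact ⟨p, hp.mem_subdiffTV, hg⟩
  · rintro ⟨p, hp, rfl⟩
    exact ROF.eq_T_of_mem_subdiffTV hν hp
  · rcases hlam.eq_or_lt with rfl | hlam
    · have h0 : ROF.T (Metric.ball 0 R) 0 g = g := if_pos rfl
      rw [h0, sub_zero]
    · have h1 := ROF.T_semigroup hN hR hg hlam (sub_pos.2 hmu)
      rwa [add_sub_cancel] at h1
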